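/- Let $\Psi=(\Psi_1,\Psi_2,\Psi_3)$ and $\Phi=(\Phi_1,\Phi_2,\Phi_3)$ be smooth maps $\mathbb{R}^4\to\mathbb{R}^3$, where $\mathbb{R}^4$ has coordinates $(\mathbf{x},y)=(x_1,x_2,x_3,y)$, and let $$\Lambda=\Psi_1\,\partial_{x_2}\wedge\partial_{x_3}+\Psi_2\,\partial_{x_3}\wedge\partial_{x_1}+\Psi_3\,\partial_{x_1}\wedge\partial_{x_2}+\sum_{i=1}^{3}\Phi_i\,\partial_{x_i}\wedge\partial_y .$$ Let $\Lambda^{\#}$ be the associated map from covectors to vectors, $$\Lambda^{\#}(df)=\Big(\Psi\times\nabla f-\frac{\partial f}{\partial y}\Phi\Big)\frac{\partial}{\partial\mathbf{x}}+(\nabla f\cdot\Phi)\frac{\partial}{\partial y},$$ where $\nabla$ is the gradient in $\mathbf{x}$. Write $X_f=\Lambda^{\#}(df)$ and $\{f,g\}=dg(X_f)$. Assume that $\Lambda$ is a Poisson tensor, i.e. $\{f,\{g,h\}\}+\{h,\{f,g\}\}+\{g,\{h,f\}\}=0$ for all smooth $f,g,h$ on $\mathbb{R}^4$. The rank of $\Lambda$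 at $p$ is the dimension of the image of $\Lambda^{\#}$ at $p$. A leaf of the characteristic foliation of $\Lambda$ is an orbit of the family of Hamiltonian vector fields $X_H$, $H\in C^\infty(\mathbb{R}^4)$: the leaf through $p$ consists of all points that can be reached from $p$ along finitely many consecutive integral curves of such fields. A leaf $L$ is a $k$-dimensional symplectic leaf if it is the image of an injective immersion of a connected smooth $k$-manifold such that the tangent space of $L$ at each $q\in L$ is the image of $\Lambda^{\#}$ at $q$, and $L$ carries a symplectic form $\Omega_L$ (a smooth, closed, nondegenerate 2-form on that manifold) with $\Omega_L(X_f,X_g)=\{f,g\}|_L$ for all smooth $f,g$ on $\mathbb{R}^4$. Put $\Phi^2=\Phi\cdot\Phi$, $\Psi^2=\Psi\cdot\Psi$. 1. For every $p\in\mathbb{R}^4$, the rank of $\Lambda$ at $p$ is $0$ if and only if $(\Phi^2+\Psi^2)(p)=0$; it is $2$ if and only if $(\Phi^2+\Psi^2)(p)\neq0$ and $(\Phi\cdot\Psi)(p)=0$; and it is $4$ if and only if $(\Phi\cdot\Psi)(p)\neq0$. 2. The sets $S^{+}=\{\Phi\cdot\Psi>0\}$ and $S^{-}=\{\Phi\cdot\Psi<0\}$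 are open, and the 4-dimensional symplectic leaves of $\Lambda$ are exactly the connected components of $S^{+}$ and the connected components of $S^{-}$. In particular, if $S^{+}$ (or $S^{-}$) is non-empty and connected, it is itself a 4-dimensional symplectic leaf. 3. The set $\{\Phi\cdot\Psi=0\}$ is the disjoint union of the leaves of $\Lambda$ contained in it, and each of these is a symplectic leaf of dimension 2 or 0. -/

import Mathlib

open scoped ContDiff Manifold Matrix

namespace PoissonR4

noncomputable section

/-- The vector space `ℝ³`; only its topology, its smooth structure and the elementary operations
`⬝ᵥ` and `⨯₃` are used. -/
abbrev R3 : Type := Fin 3 → ℝ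

/-- `ℝ⁴` with global coordinates `(𝐱, y)`. -/
abbrev R4 : Type := R3 × ℝ

/-- The components `(α(∂/∂x₁), α(∂/∂x₂), α(∂/∂x₃))` of a covector; for `α = df` this is `∇f`. -/
def spatial (α : R4 →L[ℝ] ℝ) : R3 := fun i => α (Pi.single i 1, 0)

/-- The component `α(∂/∂y)` of a covector; for `α = df` this is `∂f/∂y`. -/
def vertical (α : R4 →L[ℝ] ℝ) : ℝ := α (0, 1)

/-- The value at `p` of the morphism `Λ^#` from covectors to vectors given by the bivector field
`Λ = Ψ ∂/∂𝐱 ∧ ∂/∂𝐱 + Φ ∂/∂𝐱 ∧ ∂/∂y`; for `α = df` it is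
`(Ψ × ∇f - (∂f/∂y) Φ) ∂/∂𝐱 + (∇f · Φ) ∂/∂y`. -/
def sharp (Ψ Φ : R4 → R3) (p : R4) : (R4 →L[ℝ] ℝ) →ₗ[ℝ] R4 where
  toFun α := (Ψ p ⨯₃ spatial α - vertical α • Φ p, spatial α ⬝ᵥ Φ p)
  map_add' α β := by
    have h : spatial (α + β) = spatial α + spatial β := rfl
    have h' : vertical (α + β) = vertical α + vertical β := rfl
    rw [h, h', map_add, add_smul, add_dotProduct, Prod.mk_add_mk]
    congr 1
    abel
  map_smul' c α := by
    have h : spatial (c • α) = c • spatial α := rfl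
    have h' : vertical (c • α) = c * vertical α := rfl
    rw [h, h', map_smul, mul_smul, smul_dotProduct, ← smul_sub]
    rfl

/-- The bivector `u ∧ v`, as a form on covectors. -/
def wedge (u v : R4) (α β : R4 →L[ℝ] ℝ) : ℝ := α u * β v - α v * β u

/-- The coordinate vectors `∂/∂x₁, ∂/∂x₂, ∂/∂x₃` are `dx 0, dx 1, dx 2`. -/
def dx (i : Fin 3) : R4 := (Pi.single i 1, 0)

/-- The coordinate vector `∂/∂y`. -/
def dy : R4 := (0, 1)

/-- The antisymmetric contravariant 2-tensor `Λ = (Ψ, Φ)` at the point `p`. -/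
def bivector (Ψ Φ : R4 → R3) (p : R4) (α β : R4 →L[ℝ] ℝ) : ℝ :=
  Ψ p 0 * wedge (dx 1) (dx 2) α β + Ψ p 1 * wedge (dx 2) (dx 0) α β
    + Ψ p 2 * wedge (dx 0) (dx 1) α β
    + Φ p 0 * wedge (dx 0) dy α β + Φ p 1 * wedge (dx 1) dy α β + Φ p 2 * wedge (dx 2) dy α β

/-- `sharp` is the morphism determined by the 2-tensor: `β(Λ^#(α)) = Λ(α, β)`. -/
theorem apply_sharp (Ψ Φ : R4 → R3) (p : R4) (α β : R4 →L[ℝ] ℝ) :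
    β (sharp Ψ Φ p α) = bivector Ψ Φ p α β := by
  have key : ∀ (w : R3) (t : ℝ),
      β (w, t) = w 0 * β (dx 0) + w 1 * β (dx 1) + w 2 * β (dx 2) + t * β dy := by
    intro w t
    have : ((w, t) : R4) = w 0 • dx 0 + w 1 • dx 1 + w 2 • dx 2 + t • dy := by
      refine Prod.ext ?_ ?_
      · funext i
        fin_cases i <;> simp [dx, dy]
      · simp [dx, dy]
    rw [this]
    simp only [map_add, map_smul, smul_eq_mul]
  change β (Ψ p ⨯₃ spatial α - vertical α • Φ p, spatial α ⬝ᵥ Φ p) = _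
  rw [key]
  have hs : ∀ i, spatial α i = α (dx i) := fun _ => rfl
  have hv : vertical α = α dy := rfl
  simp only [cross_apply, bivector, wedge, dotProduct, Fin.sum_univ_three, Pi.sub_apply,
    Pi.smul_apply, smul_eq_mul, Matrix.cons_val_zero, Matrix.cons_val_one, Matrix.cons_val, hs, hv]
  ring

/-- The rank of `Λ = (Ψ, Φ)` at the point `p`. -/
def rank (Ψ Φ : R4 → R3) (p : R4) : ℕ := Module.finrank ℝ (LinearMap.range (sharp Ψ Φ p))

/-- The Hamiltonian vector field `X_H = Λ^#(dH)`. -/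
def hamiltonianField (Ψ Φ : R4 → R3) (H : R4 → ℝ) (p : R4) : R4 := sharp Ψ Φ p (fderiv ℝ H p)

/-- The bracket `{f, g} = dg(Λ^#(df))`. -/
def bracket (Ψ Φ : R4 → R3) (f g : R4 → ℝ) (p : R4) : ℝ :=
  fderiv ℝ g p (hamiltonianField Ψ Φ f p)

/-- `Λ = (Ψ, Φ)` is a Poisson tensor on `ℝ⁴`: its coefficients are smooth and its bracket satisfies
the Jacobi identity on smooth functions. -/
structure IsPoissonTensor (Ψ Φ : R4 → R3) : Prop where
  smooth_Ψ : ContDiff ℝ ∞ Ψ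
  smooth_Φ : ContDiff ℝ ∞ Φ
  jacobi : ∀ f g h : R4 → ℝ, ContDiff ℝ ∞ f → ContDiff ℝ ∞ g → ContDiff ℝ ∞ h → ∀ p : R4,
    bracket Ψ Φ f (bracket Ψ Φ g h) p + bracket Ψ Φ h (bracket Ψ Φ f g) p
      + bracket Ψ Φ g (bracket Ψ Φ h f) p = 0

/-- `q` is reached from `p` along one integral curve of a Hamiltonian vector field. (The time
interval is `[0, 1]` without loss of generality, since `X_{cH} = c X_H`.) -/
def HamiltonianArc (Ψ Φ : R4 → R3) (p q : R4) : Prop :=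
  ∃ (H : R4 → ℝ) (γ : ℝ → R4), ContDiff ℝ ∞ H ∧ γ 0 = p ∧ γ 1 = q ∧
    IsIntegralCurveOn γ (fun _ => hamiltonianField Ψ Φ H) (Set.Icc 0 1)

/-- The leaf through `p` of the characteristic foliation of `Λ`, that is, the orbit of `p` under the
family of Hamiltonian vector fields: all points that are reached from `p` along finitely many
consecutive integral curves of Hamiltonian vector fields. -/
def leaf (Ψ Φ : R4 → R3) (p : R4) : Set R4 :=
  {q | Relation.ReflTransGen (HamiltonianArc Ψ Φ) p q}

/-- `L` is a leaf of the characteristic foliation of `Λ`. -/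
def IsLeaf (Ψ Φ : R4 → R3) (L : Set R4) : Prop := ∃ p : R4, L = leaf Ψ Φ p

section TwoForms

variable {k : ℕ} {M : Type} [TopologicalSpace M] [ChartedSpace (EuclideanSpace ℝ (Fin k)) M]

/-- The coordinate expression of a 2-form `Ω` on the `k`-dimensional manifold `M` in the chart `e`,
i.e. the pull-back of `Ω` by `e⁻¹`. -/
def formInChart (Ω : ∀ m : M, TangentSpace (𝓡 k) m [⋀^Fin 2]→L[ℝ] ℝ)
    (e : OpenPartialHomeomorph M (EuclideanSpace ℝ (Fin k))) (x : EuclideanSpace ℝ (Fin k)) :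
    EuclideanSpace ℝ (Fin k) [⋀^Fin 2]→L[ℝ] ℝ :=
  (Ω (e.symm x)).compContinuousLinearMap (mfderiv (𝓡 k) (𝓡 k) e.symm x)

/-- `Ω` is a symplectic form on `M`: a smooth, closed, nondegenerate 2-form. -/
structure IsSymplecticForm (Ω : ∀ m : M, TangentSpace (𝓡 k) m [⋀^Fin 2]→L[ℝ] ℝ) : Prop where
  smooth : ∀ e ∈ atlas (EuclideanSpace ℝ (Fin k)) M, ContDiffOn ℝ ∞ (formInChart Ω e) e.target
  closed : ∀ e ∈ atlas (EuclideanSpace ℝ (Fin k)) M, ∀ x ∈ e.target,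
    extDeriv (formInChart Ω e) x = 0
  nondegenerate : ∀ (m : M) (u : TangentSpace (𝓡 k) m),
    (∀ v : TangentSpace (𝓡 k) m, Ω m ![u, v] = 0) → u = 0

/-- `ι : M → ℝ⁴` presents the set `L` as an immersed submanifold that is an integral manifold of the
characteristic distribution of `Λ`: `ι` is an injective immersion of the manifold `M` with image `L`,
and the tangent space of `L` at every point is the image of `Λ^#` there. -/
structure IsIntegralImmersion (Ψ Φ : R4 → R3) (L : Set R4) (ι : M → R4) : Prop where
  smooth : ContMDiff (𝓡 k) 𝓘(ℝ, R4) ∞ ι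
  injective : Function.Injective ι
  immersion : ∀ m : M, Function.Injective (mfderiv (𝓡 k) 𝓘(ℝ, R4) ι m)
  range_eq : Set.range ι = L
  tangent : ∀ (m : M) (w : R4),
    (∃ u : TangentSpace (𝓡 k) m, mfderiv (𝓡 k) 𝓘(ℝ, R4) ι m u = w) ↔
      w ∈ LinearMap.range (sharp Ψ Φ (ι m))

end TwoForms

/-- `L` is a `k`-dimensional symplectic leaf of `Λ`: a leaf of the characteristic foliation which is
a connected `k`-dimensional immersed submanifold, tangent to the characteristic distribution and
carrying a symplectic form `Ω` with `Ω(X_f, X_g) = {f, g}` on `L`. -/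
def IsSymplecticLeaf (Ψ Φ : R4 → R3) (k : ℕ) (L : Set R4) : Prop :=
  IsLeaf Ψ Φ L ∧
    ∃ (M : Type) (_ : TopologicalSpace M) (_ : ChartedSpace (EuclideanSpace ℝ (Fin k)) M)
      (ι : M → R4) (Ω : ∀ m : M, TangentSpace (𝓡 k) m [⋀^Fin 2]→L[ℝ] ℝ),
      IsManifold (𝓡 k) ∞ M ∧ ConnectedSpace M ∧ IsIntegralImmersion (k := k) Ψ Φ L ι ∧
        IsSymplecticForm Ω ∧
        ∀ f g : R4 → ℝ, ContDiff ℝ ∞ f → ContDiff ℝ ∞ g →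
          ∀ (m : M) (u v : TangentSpace (𝓡 k) m),
            mfderiv (𝓡 k) 𝓘(ℝ, R4) ι m u = hamiltonianField Ψ Φ f (ι m) →
            mfderiv (𝓡 k) 𝓘(ℝ, R4) ι m v = hamiltonianField Ψ Φ g (ι m) →
            Ω m ![u, v] = bracket Ψ Φ f g (ι m)

/-- The open set `S⁺ = {Φ · Ψ > 0}`. -/
def Splus (Ψ Φ : R4 → R3) : Set R4 := {p | 0 < Φ p ⬝ᵥ Ψ p}

/-- The open set `S⁻ = {Φ · Ψ < 0}`. -/
def Sminus (Ψ Φ : R4 → R3) : Set R4 := {p | Φ p ⬝ᵥ Ψ p < 0}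

/-- The set `{Φ · Ψ = 0}`. -/
def Szero (Ψ Φ : R4 → R3) : Set R4 := {p | Φ p ⬝ᵥ Ψ p = 0}

/-- `C` is a connected component of the subset `S` of `ℝ⁴`. -/
def IsComponentOf (C S : Set R4) : Prop := ∃ p ∈ S, C = connectedComponentIn S p

end

end PoissonR4

open PoissonR4

open PoissonR4

namespace PoissonR4

/-! ### Pointwise linear algebra: rank and Pfaffian -/

section PointwiseAlgebra

variable {Ψ Φ : R4 → R3} {p : R4}

/-! At a point, `Λ` is an antisymmetric 4 × 4 matrix with Pfaffian F = Φ · Ψ. If F ≠ 0, the matrix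
is invertible, and exchanging Ψ and Φ gives its inverse up to a factor (`sharp_flat`). If F = 0, the
Plücker relation (`plucker`) makes `Λ` decomposable, so the rank is 2 or 0.

The Poisson condition enters only through the Jacobi identity for linear functions
(`jacobi_covectors`), with three consequences. Hamiltonian flows preserve Λ ∧ Λ, so F solves a
linear differential equation along Hamiltonian arcs (`fderiv_pfaffian_sharp`) and on each leaf is
positive, negative or zero throughout. The fields of linear functions have their commutators in the
characteristic distribution (`lieBracket_sharp`). The 2-form inverse to `Λ` is closed where F ≠ 0
(`extDeriv_formFour`).

Where F ≠ 0, short straight segments are Hamiltonian arcs (`hamiltonianArc_of_transversal`), so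
leaves are open; disjoint, arcwise connected and contained in S⁺ or S⁻, they are its components.
Where `Λ` vanishes, uniqueness for differential equations makes the point a leaf.

The hard case is F = 0 with `Λ` ≠ 0: the rank may be 4 at nearby points, so the usual Frobenius
theorem does not apply. Two linear functions with nonzero bracket serve as coordinates, and the
horizontal lift of their plane is integrable at the points of {F = 0}. This set is invariant, which
is enough for the exponential map to sweep out an integral surface
(`exists_hasFDerivAt_eq_of_symmetric`). These surfaces, the plaques, are charts for a topology on
the leaf in which Hamiltonian arcs are continuous; hence the leaf is a connected surface. Its
symplectic form is the restriction of the 2-form (Ψ, Φ) / (Φ² + Ψ²), closed for reasons of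
dimension. -/

theorem apply_sharp_eq (α β : R4 →L[ℝ] ℝ) :
    β (sharp Ψ Φ p α) =
      Ψ p 0 * (α (dx 1) * β (dx 2) - β (dx 1) * α (dx 2))
      + Ψ p 1 * (α (dx 2) * β (dx 0) - β (dx 2) * α (dx 0))
      + Ψ p 2 * (α (dx 0) * β (dx 1) - β (dx 0) * α (dx 1))
      + Φ p 0 * (α (dx 0) * β dy - β (dx 0) * α dy)
      + Φ p 1 * (α (dx 1) * β dy - β (dx 1) * α dy)
      + Φ p 2 * (α (dx 2) * β dy - β (dx 2) * α dy) := by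
  rw [apply_sharp]
  simp only [bivector, wedge]
  ring

theorem apply_sharp_antisymm (α β : R4 →L[ℝ] ℝ) :
    β (sharp Ψ Φ p α) = -α (sharp Ψ Φ p β) := by
  simp only [apply_sharp_eq]
  ring

theorem apply_sharp_self (α : R4 →L[ℝ] ℝ) : α (sharp Ψ Φ p α) = 0 := by
  simp only [apply_sharp_eq]
  ring

/-- The coordinate covectors `dx₁, dx₂, dx₃`. -/
noncomputable def cdx (i : Fin 3) : R4 →L[ℝ] ℝ :=
  (ContinuousLinearMap.proj i).comp (ContinuousLinearMap.fst ℝ R3 ℝ)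

/-- The coordinate covector `dy`. -/
noncomputable def cdy : R4 →L[ℝ] ℝ := ContinuousLinearMap.snd ℝ R3 ℝ

theorem cdx_dx (i j : Fin 3) : cdx i (dx j) = if i = j then 1 else 0 := by
  simp [cdx, dx, Pi.single_apply]

theorem cdx_dy (i : Fin 3) : cdx i dy = 0 := by simp [cdx, dy]

theorem cdy_dx (i : Fin 3) : cdy (dx i) = 0 := by simp [cdy, dx]

theorem cdy_dy : cdy dy = 1 := by simp [cdy, dy]

theorem vector_eq (v : R4) :
    v = v.1 0 • dx 0 + v.1 1 • dx 1 + v.1 2 • dx 2 + v.2 • dy := by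
  refine Prod.ext ?_ ?_
  · funext i
    fin_cases i <;> simp [dx, dy]
  · simp [dx, dy]

theorem covector_apply (α : R4 →L[ℝ] ℝ) (v : R4) :
    α v = v.1 0 * α (dx 0) + v.1 1 * α (dx 1) + v.1 2 * α (dx 2) + v.2 * α dy := by
  conv_lhs => rw [vector_eq v]
  simp only [map_add, map_smul, smul_eq_mul]

theorem vector_ext {u v : R4} (h : ∀ η : R4 →L[ℝ] ℝ, η u = η v) : u = v := by
  refine Prod.ext (funext fun i => ?_) ?_
  · exact h (cdx i)
  · exact h cdy

/-- The Plücker relation satisfied by a bivector of rank at most two. -/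
theorem plucker (hF : Φ p ⬝ᵥ Ψ p = 0) (α β η : R4 →L[ℝ] ℝ) :
    β (sharp Ψ Φ p α) • sharp Ψ Φ p η + η (sharp Ψ Φ p β) • sharp Ψ Φ p α
      + α (sharp Ψ Φ p η) • sharp Ψ Φ p β = 0 := by
  refine vector_ext fun ζ => ?_
  simp only [map_add, map_smul, smul_eq_mul, map_zero, apply_sharp_eq]
  simp only [dotProduct, Fin.sum_univ_three] at hF
  generalize α (dx 0) = a0, α (dx 1) = a1, α (dx 2) = a2, α dy = a3
  generalize β (dx 0) = b0, β (dx 1) = b1, β (dx 2) = b2, β dy = b3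
  generalize η (dx 0) = c0, η (dx 1) = c1, η (dx 2) = c2, η dy = c3
  generalize ζ (dx 0) = d0, ζ (dx 1) = d1, ζ (dx 2) = d2, ζ dy = d3
  -- The left side is the Pfaffian of the 4 × 4 matrix of brackets of `α, β, η, ζ`, which equals Φ ·
  -- Ψ times the determinant of their components.
  linear_combination
    (a0 * (b1 * (c2 * d3 - c3 * d2) - b2 * (c1 * d3 - c3 * d1) + b3 * (c1 * d2 - c2 * d1))
    - a1 * (b0 * (c2 * d3 - c3 * d2) - b2 * (c0 * d3 - c3 * d0) + b3 * (c0 * d2 - c2 * d0))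
    + a2 * (b0 * (c1 * d3 - c3 * d1) - b1 * (c0 * d3 - c3 * d0) + b3 * (c0 * d1 - c1 * d0))
    - a3 * (b0 * (c1 * d2 - c2 * d1) - b1 * (c0 * d2 - c2 * d0) + b2 * (c0 * d1 - c1 * d0))) * hF

/-- The covector `(A, b)`. -/
noncomputable def covec (A : R3) (b : ℝ) : R4 →L[ℝ] ℝ :=
  A 0 • cdx 0 + A 1 • cdx 1 + A 2 • cdx 2 + b • cdy

theorem covec_dx (A : R3) (b : ℝ) (i : Fin 3) : covec A b (dx i) = A i := by
  fin_cases i <;> simp [covec, cdx_dx, cdy_dx]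

theorem covec_dy (A : R3) (b : ℝ) : covec A b dy = b := by
  simp [covec, cdx_dy, cdy_dy]

/-- Where `Φ · Ψ ≠ 0`, this covector is mapped to `v` by `Λ^#`. -/
noncomputable def flat (Ψ Φ : R4 → R3) (p v : R4) : R4 →L[ℝ] ℝ :=
  (Φ p ⬝ᵥ Ψ p)⁻¹ • covec (v.2 • Ψ p + v.1 ⨯₃ Φ p) (-(v.1 ⬝ᵥ Ψ p))

/-- Composing `Λ^#` with the same map for Ψ and Φ exchanged gives -(Φ · Ψ) times the identity;
`flat` is that second map divided by -(Φ · Ψ). -/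
theorem sharp_flat (hF : Φ p ⬝ᵥ Ψ p ≠ 0) (v : R4) : sharp Ψ Φ p (flat Ψ Φ p v) = v := by
  refine vector_ext fun η => ?_
  rw [flat, map_smul, map_smul, smul_eq_mul, apply_sharp_eq, covector_apply η v,
    inv_mul_eq_iff_eq_mul₀ hF]
  simp only [covec_dx, covec_dy, cross_apply, dotProduct, Fin.sum_univ_three, Pi.add_apply,
    Pi.smul_apply, smul_eq_mul, Matrix.cons_val_zero, Matrix.cons_val_one, Matrix.cons_val]
  ring

theorem range_sharp_eq_top (hF : Φ p ⬝ᵥ Ψ p ≠ 0) : LinearMap.range (sharp Ψ Φ p) = ⊤ :=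
  LinearMap.range_eq_top.2 fun v => ⟨_, sharp_flat hF v⟩

theorem norm_sq_eq_zero_iff :
    Φ p ⬝ᵥ Φ p + Ψ p ⬝ᵥ Ψ p = 0 ↔ Φ p = 0 ∧ Ψ p = 0 := by
  constructor
  · intro h
    have h1 : 0 ≤ Φ p ⬝ᵥ Φ p := Finset.sum_nonneg fun i _ => mul_self_nonneg _
    have h2 : 0 ≤ Ψ p ⬝ᵥ Ψ p := Finset.sum_nonneg fun i _ => mul_self_nonneg _
    exact ⟨dotProduct_self_eq_zero.1 (by linarith), dotProduct_self_eq_zero.1 (by linarith)⟩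
  · rintro ⟨h1, h2⟩
    simp [h1, h2]

theorem sharp_eq_zero (h : Φ p ⬝ᵥ Φ p + Ψ p ⬝ᵥ Ψ p = 0) : sharp Ψ Φ p = 0 := by
  obtain ⟨h1, h2⟩ := norm_sq_eq_zero_iff.1 h
  ext1 α
  simp [sharp, h1, h2]

theorem exists_apply_sharp_ne_zero (h : Φ p ⬝ᵥ Φ p + Ψ p ⬝ᵥ Ψ p ≠ 0) :
    ∃ α β : R4 →L[ℝ] ℝ, β (sharp Ψ Φ p α) ≠ 0 := by
  by_contra! hc
  -- The components are brackets of coordinates: Φᵢ = {xᵢ, y} and Ψᵢ = {xᵢ₊₁, xᵢ₊₂}, with indices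
  -- modulo 3.
  refine h (norm_sq_eq_zero_iff.2 ⟨funext fun i => ?_, funext fun i => ?_⟩)
  · have := hc (cdx i) cdy
    fin_cases i <;> simpa [apply_sharp_eq, cdx_dx, cdx_dy, cdy_dx, cdy_dy] using this
  · have := hc (cdx (i + 1)) (cdx (i + 2))
    fin_cases i <;> simpa [apply_sharp_eq, cdx_dx, cdx_dy, cdy_dx, cdy_dy] using this

/-- The Plücker relation solved for `Λ^#(η)`: two covectors with nonzero bracket already generate
the image, with coefficients that are brackets. -/
theorem sharp_mem_span_pair (hF : Φ p ⬝ᵥ Ψ p = 0) {α β : R4 →L[ℝ] ℝ}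
    (hk : β (sharp Ψ Φ p α) ≠ 0) (η : R4 →L[ℝ] ℝ) :
    sharp Ψ Φ p η = (β (sharp Ψ Φ p α))⁻¹ •
      (β (sharp Ψ Φ p η) • sharp Ψ Φ p α - α (sharp Ψ Φ p η) • sharp Ψ Φ p β) := by
  rw [eq_inv_smul_iff₀ hk]
  have := plucker hF α β η
  rw [apply_sharp_antisymm β η, neg_smul] at this
  linear_combination this

theorem rank_eq_zero (h : Φ p ⬝ᵥ Φ p + Ψ p ⬝ᵥ Ψ p = 0) : rank Ψ Φ p = 0 := by
  rw [rank, sharp_eq_zero h, LinearMap.range_zero, finrank_bot]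

theorem rank_eq_two (h : Φ p ⬝ᵥ Φ p + Ψ p ⬝ᵥ Ψ p ≠ 0) (hF : Φ p ⬝ᵥ Ψ p = 0) :
    rank Ψ Φ p = 2 := by
  obtain ⟨α, β, hk⟩ := exists_apply_sharp_ne_zero h
  have hli : LinearIndependent ℝ ![sharp Ψ Φ p α, sharp Ψ Φ p β] := by
    rw [LinearIndependent.pair_iff]
    intro s t hst
    have h1 := congrArg β hst
    have h2 := congrArg α hst
    simp only [map_add, map_smul, smul_eq_mul, apply_sharp_self, map_zero, mul_zero, add_zero,
      zero_add] at h1 h2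
    rw [apply_sharp_antisymm] at h2
    exact ⟨(mul_eq_zero.1 h1).resolve_right hk,
      (mul_eq_zero.1 h2).resolve_right (neg_ne_zero.2 hk)⟩
  have hr : LinearMap.range (sharp Ψ Φ p)
      = Submodule.span ℝ (Set.range ![sharp Ψ Φ p α, sharp Ψ Φ p β]) := by
    apply le_antisymm
    · rintro _ ⟨η, rfl⟩
      rw [sharp_mem_span_pair hF hk η]
      exact Submodule.smul_mem _ _ (Submodule.sub_mem _
        (Submodule.smul_mem _ _ (Submodule.subset_span ⟨0, rfl⟩))
        (Submodule.smul_mem _ _ (Submodule.subset_span ⟨1, rfl⟩)))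
    · rw [Submodule.span_le]
      rintro _ ⟨i, rfl⟩
      fin_cases i
      exacts [⟨α, rfl⟩, ⟨β, rfl⟩]
  rw [rank, hr, finrank_span_eq_card hli, Fintype.card_fin]

theorem rank_eq_four (hF : Φ p ⬝ᵥ Ψ p ≠ 0) : rank Ψ Φ p = 4 := by
  rw [rank, range_sharp_eq_top hF, finrank_top, Module.finrank_prod]
  simp

theorem rank_characterization (Ψ Φ : R4 → R3) (p : R4) :
    (rank Ψ Φ p = 0 ↔ Φ p ⬝ᵥ Φ p + Ψ p ⬝ᵥ Ψ p = 0) ∧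
    (rank Ψ Φ p = 2 ↔ Φ p ⬝ᵥ Φ p + Ψ p ⬝ᵥ Ψ p ≠ 0 ∧ Φ p ⬝ᵥ Ψ p = 0) ∧
    (rank Ψ Φ p = 4 ↔ Φ p ⬝ᵥ Ψ p ≠ 0) := by
  by_cases hN : Φ p ⬝ᵥ Φ p + Ψ p ⬝ᵥ Ψ p = 0
  · have hF : Φ p ⬝ᵥ Ψ p = 0 := by simp [(norm_sq_eq_zero_iff.1 hN).1]
    simp [rank_eq_zero hN, hN, hF]
  · by_cases hF : Φ p ⬝ᵥ Ψ p = 0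
    · simp [rank_eq_two hN hF, hN, hF]
    · simp [rank_eq_four hF, hN, hF]

end PointwiseAlgebra

/-! ### Two-forms dual to the bivector -/

section DualForms

/-- The 2-form `A · (d𝐱 × d𝐱) / 2 + B · d𝐱 ∧ dy` on `ℝ⁴`. -/
noncomputable def twoForm (A B : R3) : R4 [⋀^Fin 2]→L[ℝ] ℝ where
  toFun v := A ⬝ᵥ ((v 0).1 ⨯₃ (v 1).1) + B ⬝ᵥ ((v 1).2 • (v 0).1 - (v 0).2 • (v 1).1)
  map_update_add' v i x y := by
    fin_cases i <;>
    · simp [cross_apply, dotProduct, Fin.sum_univ_three]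
      ring
  map_update_smul' v i c x := by
    fin_cases i <;>
    · simp [cross_apply, dotProduct, Fin.sum_univ_three]
      ring
  map_eq_zero_of_eq' v i j h hij := by
    have h01 : v 0 = v 1 := by
      fin_cases i <;> fin_cases j <;> simp_all
    simp [h01]
  cont := by
    simp only [cross_apply, dotProduct, Fin.sum_univ_three]
    simp
    fun_prop

theorem twoForm_apply (A B : R3) (u v : R4) :
    twoForm A B ![u, v] = A ⬝ᵥ (u.1 ⨯₃ v.1) + B ⬝ᵥ (v.2 • u.1 - u.2 • v.1) := rfl

variable {Ψ Φ : R4 → R3} {p : R4}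

theorem twoForm_sharp_sharp_of_ne_zero (hF : Φ p ⬝ᵥ Ψ p ≠ 0) (α β : R4 →L[ℝ] ℝ) :
    twoForm ((Φ p ⬝ᵥ Ψ p)⁻¹ • Φ p) ((Φ p ⬝ᵥ Ψ p)⁻¹ • Ψ p) ![sharp Ψ Φ p α, sharp Ψ Φ p β]
      = β (sharp Ψ Φ p α) := by
  rw [twoForm_apply, smul_dotProduct, smul_dotProduct, ← smul_add, smul_eq_mul,
    inv_mul_eq_iff_eq_mul₀ hF, apply_sharp_eq]
  have hα : ∀ i, spatial α i = α (dx i) := fun _ => rfl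
  have hβ : ∀ i, spatial β i = β (dx i) := fun _ => rfl
  have hα' : vertical α = α dy := rfl
  have hβ' : vertical β = β dy := rfl
  simp only [sharp, LinearMap.coe_mk, AddHom.coe_mk, cross_apply, dotProduct, Fin.sum_univ_three,
    Pi.sub_apply, Pi.smul_apply, smul_eq_mul, Matrix.cons_val_zero, Matrix.cons_val_one,
    Matrix.cons_val, hα, hβ, hα', hβ']
  ring

/-- There is no inverse form in rank two, but only values on the image of `Λ^#` matter. If Λ = u ∧
v, then Λ^#(α) ∧ Λ^#(β) = Λ(α, β) Λ, and pairing with Λ / |Λ|² returns Λ(α, β). No choice of u and v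
is needed, so the form is smooth wherever `Λ` ≠ 0. -/
theorem twoForm_sharp_sharp_of_eq_zero (hN : Φ p ⬝ᵥ Φ p + Ψ p ⬝ᵥ Ψ p ≠ 0)
    (hF : Φ p ⬝ᵥ Ψ p = 0) (α β : R4 →L[ℝ] ℝ) :
    twoForm ((Φ p ⬝ᵥ Φ p + Ψ p ⬝ᵥ Ψ p)⁻¹ • Ψ p) ((Φ p ⬝ᵥ Φ p + Ψ p ⬝ᵥ Ψ p)⁻¹ • Φ p)
      ![sharp Ψ Φ p α, sharp Ψ Φ p β] = β (sharp Ψ Φ p α) := by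
  rw [twoForm_apply, smul_dotProduct, smul_dotProduct, ← smul_add, smul_eq_mul,
    inv_mul_eq_iff_eq_mul₀ hN, apply_sharp_eq]
  have hα : ∀ i, spatial α i = α (dx i) := fun _ => rfl
  have hβ : ∀ i, spatial β i = β (dx i) := fun _ => rfl
  have hα' : vertical α = α dy := rfl
  have hβ' : vertical β = β dy := rfl
  simp only [sharp, LinearMap.coe_mk, AddHom.coe_mk, cross_apply, dotProduct, Fin.sum_univ_three,
    Pi.sub_apply, Pi.smul_apply, smul_eq_mul, Matrix.cons_val_zero, Matrix.cons_val_one,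
    Matrix.cons_val, hα, hβ, hα', hβ'] at hF ⊢
  generalize α (dx 0) = a0, α (dx 1) = a1, α (dx 2) = a2, α dy = a3
  generalize β (dx 0) = b0, β (dx 1) = b1, β (dx 2) = b2, β dy = b3
  linear_combination
    (-(Φ p 0 * (a1 * b2 - a2 * b1) + Φ p 1 * (a2 * b0 - a0 * b2) + Φ p 2 * (a0 * b1 - a1 * b0)
      + Ψ p 0 * (a0 * b3 - a3 * b0) + Ψ p 1 * (a1 * b3 - a3 * b1)
      + Ψ p 2 * (a2 * b3 - a3 * b2))) * hF

end DualForms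

end PoissonR4

namespace PoissonR4

/-! ### Consequences of the Jacobi identity -/

section Derivatives

variable {Ψ Φ : R4 → R3}

/-- `Λ^#` at `p` as a continuous linear map. -/
noncomputable def sharpL (Ψ Φ : R4 → R3) (p : R4) : (R4 →L[ℝ] ℝ) →L[ℝ] R4 :=
  LinearMap.toContinuousLinearMap (sharp Ψ Φ p)

theorem sharpL_apply (p : R4) (α : R4 →L[ℝ] ℝ) : sharpL Ψ Φ p α = sharp Ψ Φ p α := rfl

namespace IsPoissonTensor

variable (hΛ : IsPoissonTensor Ψ Φ)

include hΛ

theorem contDiff_Ψ_apply (i : Fin 3) : ContDiff ℝ ∞ fun x => Ψ x i :=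
  contDiff_pi.1 hΛ.smooth_Ψ i

theorem contDiff_Φ_apply (i : Fin 3) : ContDiff ℝ ∞ fun x => Φ x i :=
  contDiff_pi.1 hΛ.smooth_Φ i

theorem contDiff_apply_sharp (α β : R4 →L[ℝ] ℝ) :
    ContDiff ℝ ∞ fun x => β (sharp Ψ Φ x α) := by
  have h1 := hΛ.contDiff_Ψ_apply
  have h2 := hΛ.contDiff_Φ_apply
  simp only [apply_sharp_eq]
  exact ((((((h1 0).mul contDiff_const).add ((h1 1).mul contDiff_const)).add
    ((h1 2).mul contDiff_const)).add ((h2 0).mul contDiff_const)).add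
    ((h2 1).mul contDiff_const)).add ((h2 2).mul contDiff_const)

theorem contDiff_sharp (α : R4 →L[ℝ] ℝ) : ContDiff ℝ ∞ fun x => sharp Ψ Φ x α :=
  (contDiff_pi.2 fun i => hΛ.contDiff_apply_sharp α (cdx i)).prodMk
    (hΛ.contDiff_apply_sharp α cdy)

theorem contDiff_sharpL : ContDiff ℝ ∞ (sharpL Ψ Φ) :=
  contDiff_clm_apply_iff.2 fun α => hΛ.contDiff_sharp α

theorem contDiff_pfaffian : ContDiff ℝ ∞ fun x => Φ x ⬝ᵥ Ψ x := by
  simp only [dotProduct]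
  exact ContDiff.sum fun i _ => (hΛ.contDiff_Φ_apply i).mul (hΛ.contDiff_Ψ_apply i)

theorem contDiff_norm_sq : ContDiff ℝ ∞ fun x => Φ x ⬝ᵥ Φ x + Ψ x ⬝ᵥ Ψ x := by
  simp only [dotProduct]
  exact (ContDiff.sum fun i _ => (hΛ.contDiff_Φ_apply i).mul (hΛ.contDiff_Φ_apply i)).add
    (ContDiff.sum fun i _ => (hΛ.contDiff_Ψ_apply i).mul (hΛ.contDiff_Ψ_apply i))

/-- Linear functions have constant differentials, so the Jacobi identity for them involves only
first derivatives of the coefficients of `Λ`. -/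
theorem jacobi_covectors (α β η : R4 →L[ℝ] ℝ) (p : R4) :
    fderiv ℝ (fun x => η (sharp Ψ Φ x β)) p (sharp Ψ Φ p α)
      + fderiv ℝ (fun x => β (sharp Ψ Φ x α)) p (sharp Ψ Φ p η)
      + fderiv ℝ (fun x => α (sharp Ψ Φ x η)) p (sharp Ψ Φ p β) = 0 := by
  have h := hΛ.jacobi α β η α.contDiff β.contDiff η.contDiff p
  have hb : ∀ f g : R4 →L[ℝ] ℝ, bracket Ψ Φ f g = fun x => g (sharp Ψ Φ x f) := by
    intro f g
    funext x
    simp only [bracket, hamiltonianField, ContinuousLinearMap.fderiv]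
  rw [hb, hb, hb] at h
  simpa only [bracket, hamiltonianField, ContinuousLinearMap.fderiv] using h

theorem apply_fderiv_sharp (α η : R4 →L[ℝ] ℝ) (p v : R4) :
    η (fderiv ℝ (fun x => sharp Ψ Φ x α) p v) = fderiv ℝ (fun x => η (sharp Ψ Φ x α)) p v := by
  have h := (hΛ.contDiff_sharp α).differentiable (by simp) p
  have := (η.hasFDerivAt.comp p h.hasFDerivAt).fderiv
  change _ = fderiv ℝ (⇑η ∘ fun x => sharp Ψ Φ x α) p v
  rw [this]
  rfl

/-- The commutator of the Hamiltonian fields of two linear functions is the Hamiltonian field of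
their bracket. -/
theorem lieBracket_sharp (α β : R4 →L[ℝ] ℝ) (p : R4) :
    fderiv ℝ (fun x => sharp Ψ Φ x β) p (sharp Ψ Φ p α)
      - fderiv ℝ (fun x => sharp Ψ Φ x α) p (sharp Ψ Φ p β)
      = sharp Ψ Φ p (fderiv ℝ (fun x => β (sharp Ψ Φ x α)) p) := by
  refine vector_ext fun η => ?_
  rw [map_sub, hΛ.apply_fderiv_sharp, hΛ.apply_fderiv_sharp,
    apply_sharp_antisymm _ η]
  have h := hΛ.jacobi_covectors α β η p
  have h2 : (fun x => η (sharp Ψ Φ x α)) = fun x => -α (sharp Ψ Φ x η) :=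
    funext fun x => apply_sharp_antisymm α η
  rw [h2, fderiv_fun_neg]
  simp only [neg_apply]
  linarith

end IsPoissonTensor

/-- The divergence of the vector field `Λ^#(α)`, for a constant covector `α`. -/
noncomputable def divergence (Ψ Φ : R4 → R3) (p : R4) (α : R4 →L[ℝ] ℝ) : ℝ :=
  fderiv ℝ (fun x => cdx 0 (sharp Ψ Φ x α)) p (dx 0)
    + fderiv ℝ (fun x => cdx 1 (sharp Ψ Φ x α)) p (dx 1)
    + fderiv ℝ (fun x => cdx 2 (sharp Ψ Φ x α)) p (dx 2)
    + fderiv ℝ (fun x => cdy (sharp Ψ Φ x α)) p dy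

namespace IsPoissonTensor

variable (hΛ : IsPoissonTensor Ψ Φ)

include hΛ

theorem fderiv_apply_sharp (α β : R4 →L[ℝ] ℝ) (p : R4) :
    fderiv ℝ (fun x => β (sharp Ψ Φ x α)) p =
      (α (dx 1) * β (dx 2) - β (dx 1) * α (dx 2)) • fderiv ℝ (fun x => Ψ x 0) p
      + (α (dx 2) * β (dx 0) - β (dx 2) * α (dx 0)) • fderiv ℝ (fun x => Ψ x 1) p
      + (α (dx 0) * β (dx 1) - β (dx 0) * α (dx 1)) • fderiv ℝ (fun x => Ψ x 2) p
      + (α (dx 0) * β dy - β (dx 0) * α dy) • fderiv ℝ (fun x => Φ x 0) p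
      + (α (dx 1) * β dy - β (dx 1) * α dy) • fderiv ℝ (fun x => Φ x 1) p
      + (α (dx 2) * β dy - β (dx 2) * α dy) • fderiv ℝ (fun x => Φ x 2) p := by
  have h1 := fun i => ((hΛ.contDiff_Ψ_apply i).differentiable (by simp) p).hasFDerivAt
  have h2 := fun i => ((hΛ.contDiff_Φ_apply i).differentiable (by simp) p).hasFDerivAt
  simp only [apply_sharp_eq]
  exact (((((((h1 0).mul_const _).add ((h1 1).mul_const _)).add
    ((h1 2).mul_const _)).add ((h2 0).mul_const _)).add
    ((h2 1).mul_const _)).add ((h2 2).mul_const _)).fderiv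

theorem continuous_divergence (α : R4 →L[ℝ] ℝ) : Continuous fun p => divergence Ψ Φ p α := by
  have h : ∀ (β : R4 →L[ℝ] ℝ) (v : R4),
      Continuous fun p => fderiv ℝ (fun x => β (sharp Ψ Φ x α)) p v := fun β v =>
    ((hΛ.contDiff_apply_sharp α β).continuous_fderiv (by simp)).clm_apply continuous_const
  exact (((h _ _).add (h _ _)).add (h _ _)).add (h _ _)

/-- Linearity in `α`; it gives continuity of the divergence along a curve whose covector varies with
time. -/
theorem divergence_eq (α : R4 →L[ℝ] ℝ) (p : R4) :
    divergence Ψ Φ p α = α (dx 0) * divergence Ψ Φ p (cdx 0) + α (dx 1) * divergence Ψ Φ p (cdx 1)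
      + α (dx 2) * divergence Ψ Φ p (cdx 2) + α dy * divergence Ψ Φ p cdy := by
  simp [divergence, hΛ.fderiv_apply_sharp, cdx_dx, cdx_dy, cdy_dx, cdy_dy]
  ring

/-- The Pfaffian `Φ · Ψ` is multiplied by the divergence along Hamiltonian fields. -/
theorem fderiv_pfaffian_sharp (α : R4 →L[ℝ] ℝ) (p : R4) :
    fderiv ℝ (fun x => Φ x ⬝ᵥ Ψ x) p (sharp Ψ Φ p α)
      = divergence Ψ Φ p α * (Φ p ⬝ᵥ Ψ p) := by
  have h1 := fun i => ((hΛ.contDiff_Ψ_apply i).differentiable (by simp) p).hasFDerivAt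
  have h2 := fun i => ((hΛ.contDiff_Φ_apply i).differentiable (by simp) p).hasFDerivAt
  have hF : fderiv ℝ (fun x => Φ x 0 * Ψ x 0 + Φ x 1 * Ψ x 1 + Φ x 2 * Ψ x 2) p = _ :=
    ((((h2 0).mul (h1 0)).add ((h2 1).mul (h1 1))).add ((h2 2).mul (h1 2))).fderiv
  have hF' : (fun x => Φ x ⬝ᵥ Ψ x) = fun x => Φ x 0 * Ψ x 0 + Φ x 1 * Ψ x 1 + Φ x 2 * Ψ x 2 := by
    funext x
    simp only [dotProduct, Fin.sum_univ_three]
  -- The flow of Λ^#(α) preserves Λ ∧ Λ, a constant multiple of Φ · Ψ times the coordinate 4-vector;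
  -- differentiating this gives the claim. In coordinates it is a combination of the Jacobi
  -- identities of the four coordinate triples, with the components of `Λ` and `α` as multipliers.
  have J012 := hΛ.jacobi_covectors (cdx 0) (cdx 1) (cdx 2) p
  have J01y := hΛ.jacobi_covectors (cdx 0) (cdx 1) cdy p
  have J12y := hΛ.jacobi_covectors (cdx 1) (cdx 2) cdy p
  have J20y := hΛ.jacobi_covectors (cdx 2) (cdx 0) cdy p
  rw [hF', hF, divergence]
  simp only [hΛ.fderiv_apply_sharp, dotProduct, Fin.sum_univ_three] at J012 J01y J12y J20y ⊢
  simp only [cdx_dx, cdx_dy, cdy_dx, cdy_dy, add_apply, FunLike.coe_smul, Pi.smul_apply, smul_eq_mul]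
    at J012 J01y J12y J20y ⊢
  generalize fderiv ℝ (fun x => Ψ x 0) p = ψ0, fderiv ℝ (fun x => Ψ x 1) p = ψ1,
    fderiv ℝ (fun x => Ψ x 2) p = ψ2 at *
  generalize fderiv ℝ (fun x => Φ x 0) p = φ0, fderiv ℝ (fun x => Φ x 1) p = φ1,
    fderiv ℝ (fun x => Φ x 2) p = φ2 at *
  simp only [apply_sharp_eq, cdx_dx, cdx_dy, cdy_dx, cdy_dy] at J012 J01y J12y J20y ⊢
  simp at J012 J01y J12y J20y ⊢
  generalize α (dx 0) = a0, α (dx 1) = a1, α (dx 2) = a2, α dy = a3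
  linear_combination
    a0 * (-Ψ p 2 * J20y + Φ p 0 * J012 + Ψ p 1 * J01y)
    + a1 * (-Ψ p 0 * J01y + Φ p 1 * J012 + Ψ p 2 * J12y)
    + a2 * (-Ψ p 1 * J12y + Φ p 2 * J012 + Ψ p 0 * J20y)
    + a3 * (Φ p 2 * J01y + Φ p 0 * J12y + Φ p 1 * J20y)

end IsPoissonTensor

end Derivatives

end PoissonR4

namespace PoissonR4

/-! ### Smoothness of form-valued maps -/

section SmoothForms

variable {X E : Type*} [NormedAddCommGroup X] [NormedSpace ℝ X] [NormedAddCommGroup E]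
  [NormedSpace ℝ E] [FiniteDimensional ℝ E]

/-- Evaluation on tuples of basis vectors embeds the forms linearly in a finite power of ℝ, and a
linear left inverse recovers `f` from finitely many smooth functions. -/
theorem contDiffWithinAt_of_forall_apply {n : WithTop ℕ∞} {f : X → E [⋀^Fin 2]→L[ℝ] ℝ} {s : Set X}
    {x : X} (h : ∀ v, ContDiffWithinAt ℝ n (fun y => f y v) s x) : ContDiffWithinAt ℝ n f s x := by
  let b := Module.finBasis ℝ E
  let ev : (E [⋀^Fin 2]→L[ℝ] ℝ) →ₗ[ℝ] ((Fin 2 → Fin (Module.finrank ℝ E)) → ℝ) :=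
    { toFun := fun θ i => θ (fun j => b (i j))
      map_add' := fun _ _ => rfl
      map_smul' := fun _ _ => rfl }
  have hinj : Function.Injective ev := by
    intro θ₁ θ₂ h12
    refine ContinuousAlternatingMap.toAlternatingMap_injective
      (Module.Basis.ext_alternating b fun i _ => ?_)
    exact congrFun h12 i
  have : FiniteDimensional ℝ (E [⋀^Fin 2]→L[ℝ] ℝ) := FiniteDimensional.of_injective ev hinj
  obtain ⟨g, hg⟩ := ev.exists_leftInverse_of_injective (LinearMap.ker_eq_bot.2 hinj)
  have h1 : ContDiffWithinAt ℝ n (fun y => ev (f y)) s x :=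
    contDiffWithinAt_pi.2 fun i => h _
  have h2 := (LinearMap.toContinuousLinearMap g).contDiff.contDiffAt.comp_contDiffWithinAt x h1
  refine h2.congr (fun y _ => ?_) ?_
  · exact (LinearMap.congr_fun hg (f y)).symm
  · exact (LinearMap.congr_fun hg (f x)).symm

theorem contDiffAt_twoForm {n : WithTop ℕ∞} {A B : X → R3} {x : X} (hA : ContDiffAt ℝ n A x)
    (hB : ContDiffAt ℝ n B x) : ContDiffAt ℝ n (fun y => twoForm (A y) (B y)) x := by
  refine contDiffWithinAt_of_forall_apply fun v => ?_
  change ContDiffAt ℝ n (fun y => A y ⬝ᵥ ((v 0).1 ⨯₃ (v 1).1)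
    + B y ⬝ᵥ ((v 1).2 • (v 0).1 - (v 0).2 • (v 1).1)) x
  simp only [dotProduct]
  exact (ContDiffAt.sum fun i _ => (contDiffAt_pi.1 hA i).mul contDiffAt_const).add
    (ContDiffAt.sum fun i _ => (contDiffAt_pi.1 hB i).mul contDiffAt_const)

end SmoothForms

/-! ### Closedness of the inverse form in rank four -/

section LeafForms

variable {Ψ Φ : R4 → R3}

/-- The form dual to `Λ` where `Λ` has rank four. -/
noncomputable def formFour (Ψ Φ : R4 → R3) (x : R4) : R4 [⋀^Fin 2]→L[ℝ] ℝ :=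
  twoForm ((Φ x ⬝ᵥ Ψ x)⁻¹ • Φ x) ((Φ x ⬝ᵥ Ψ x)⁻¹ • Ψ x)

namespace IsPoissonTensor

variable (hΛ : IsPoissonTensor Ψ Φ)

include hΛ

theorem contDiffAt_formFour {p : R4} (hF : Φ p ⬝ᵥ Ψ p ≠ 0) :
    ContDiffAt ℝ ∞ (formFour Ψ Φ) p :=
  have h := hΛ.contDiff_pfaffian.contDiffAt.inv hF
  contDiffAt_twoForm (h.smul hΛ.smooth_Φ.contDiffAt) (h.smul hΛ.smooth_Ψ.contDiffAt)

theorem isOpen_pfaffian_ne_zero : IsOpen {x | Φ x ⬝ᵥ Ψ x ≠ 0} :=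
  isOpen_ne.preimage hΛ.contDiff_pfaffian.continuous

/-- The form dual to `Λ` is closed where `Λ` has rank four. -/
theorem extDeriv_formFour {p : R4} (hF : Φ p ⬝ᵥ Ψ p ≠ 0) : extDeriv (formFour Ψ Φ) p = 0 := by
  ext v
  -- The test vectors are extended to Hamiltonian fields of linear functions, for which both the
  -- pairings and the commutators are known near `p`.
  set a : Fin 3 → (R4 →L[ℝ] ℝ) := fun i => flat Ψ Φ p (v i) with ha
  set V : Fin 3 → R4 → R4 := fun i x => sharp Ψ Φ x (a i) with hV
  have hv : v = (V · p) := funext fun i => (sharp_flat hF (v i)).symm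
  have hd : DifferentiableAt ℝ (formFour Ψ Φ) p :=
    (hΛ.contDiffAt_formFour hF).differentiableAt (by simp)
  have key := extDeriv_apply_vectorField hd (V := V)
    fun i => (hΛ.contDiff_sharp (a i)).differentiable (by simp) p
  have hθ : ∀ x, Φ x ⬝ᵥ Ψ x ≠ 0 → ∀ α β : R4 →L[ℝ] ℝ,
      formFour Ψ Φ x ![sharp Ψ Φ x α, sharp Ψ Φ x β] = β (sharp Ψ Φ x α) := fun x hx α β =>
    twoForm_sharp_sharp_of_ne_zero hx α β
  have hder : ∀ α β : R4 →L[ℝ] ℝ,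
      fderiv ℝ (fun x => formFour Ψ Φ x ![sharp Ψ Φ x α, sharp Ψ Φ x β]) p
        = fderiv ℝ (fun x => β (sharp Ψ Φ x α)) p := fun α β =>
    Filter.EventuallyEq.fderiv_eq
      (Filter.eventuallyEq_of_mem (hΛ.isOpen_pfaffian_ne_zero.mem_nhds hF)
        fun x hx => hθ x hx α β)
  have hbr : ∀ i j, VectorField.lieBracket ℝ (V i) (V j) p
      = sharp Ψ Φ p (fderiv ℝ (fun x => a j (sharp Ψ Φ x (a i))) p) := fun i j =>
    hΛ.lieBracket_sharp (a i) (a j) p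
  have r0 : ∀ x, (0 : Fin 3).removeNth (V · x) = ![V 1 x, V 2 x] := fun x => by
    ext1 i; fin_cases i <;> rfl
  have r1 : ∀ x, (1 : Fin 3).removeNth (V · x) = ![V 0 x, V 2 x] := fun x => by
    ext1 i; fin_cases i <;> rfl
  have r2 : ∀ x, (2 : Fin 3).removeNth (V · x) = ![V 0 x, V 1 x] := fun x => by
    ext1 i; fin_cases i <;> rfl
  rw [hv, key, Fin.sum_univ_three, Fin.sum_univ_two]
  have e0 : Finset.Ici (0 : Fin 2) = {0, 1} := by decide
  have e1 : Finset.Ici (1 : Fin 2) = {1} := by decide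
  have c0 : (0 : Fin 2).castSucc = (0 : Fin 3) := rfl
  have c1 : (1 : Fin 2).castSucc = (1 : Fin 3) := rfl
  have s0 : (0 : Fin 2).succ = (1 : Fin 3) := rfl
  have s1 : (1 : Fin 2).succ = (2 : Fin 3) := rfl
  have t0 : ∀ u w : R4, (0 : Fin 2).removeNth ![u, w] = ![w] := fun u w => by
    ext1 i; fin_cases i; rfl
  have t1 : ∀ u w : R4, (1 : Fin 2).removeNth ![u, w] = ![u] := fun u w => by
    ext1 i; fin_cases i; rfl
  rw [e0, e1, Finset.sum_pair (by decide), Finset.sum_singleton]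
  simp only [c0, c1, s0, s1, r0, r1, r2, t0, t1, hbr]
  -- In Cartan's formula the derivative terms and the commutator terms now each add up to the cyclic
  -- Jacobi sum, up to sign.
  simp only [hV, hder, hθ p hF]
  have J := hΛ.jacobi_covectors (a 0) (a 1) (a 2) p
  have h20 : fderiv ℝ (fun x => a 0 (sharp Ψ Φ x (a 2))) p
      = -fderiv ℝ (fun x => a 2 (sharp Ψ Φ x (a 0))) p := by
    rw [← fderiv_fun_neg]
    exact congrArg (fderiv ℝ · p) (funext fun x => apply_sharp_antisymm _ _)
  rw [h20] at J
  have hsw : ∀ (i : Fin 3) (β : R4 →L[ℝ] ℝ), a i (sharp Ψ Φ p β) = -β (sharp Ψ Φ p (a i)) :=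
    fun i β => apply_sharp_antisymm _ _
  simp only [hsw]
  simp at J ⊢
  linarith

end IsPoissonTensor

end LeafForms

end PoissonR4

namespace PoissonR4

open Set

/-! ### Curves tangent to the characteristic distribution -/

section TangentCurves

variable {Ψ Φ : R4 → R3} {γ : ℝ → R4} {α : ℝ → R4 →L[ℝ] ℝ} {a b : ℝ}

/-- `γ` is a curve on `[a, b]` with velocity `Λ^#(α)`. -/
structure IsTangentCurve (Ψ Φ : R4 → R3) (γ : ℝ → R4) (α : ℝ → R4 →L[ℝ] ℝ) (a b : ℝ) : Prop where
  continuousOn_covector : ContinuousOn α (Icc a b)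
  hasDerivWithinAt : ∀ t ∈ Icc a b, HasDerivWithinAt γ (sharp Ψ Φ (γ t) (α t)) (Icc a b) t

namespace IsTangentCurve

theorem continuousOn (h : IsTangentCurve Ψ Φ γ α a b) : ContinuousOn γ (Icc a b) :=
  fun t ht => (h.hasDerivWithinAt t ht).continuousWithinAt

theorem mono (h : IsTangentCurve Ψ Φ γ α a b) {c d : ℝ} (hcd : Icc c d ⊆ Icc a b) :
    IsTangentCurve Ψ Φ γ α c d :=
  ⟨h.continuousOn_covector.mono hcd, fun t ht => (h.hasDerivWithinAt t (hcd ht)).mono hcd⟩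

theorem hasDerivWithinAt_Ici (h : IsTangentCurve Ψ Φ γ α a b) {t : ℝ} (ht : t ∈ Ico a b) :
    HasDerivWithinAt γ (sharp Ψ Φ (γ t) (α t)) (Ici t) t :=
  (h.hasDerivWithinAt t (Ico_subset_Icc_self ht)).mono_of_mem_nhdsWithin
    (Icc_mem_nhdsGE_of_mem ht)

theorem reverse (h : IsTangentCurve Ψ Φ γ α a b) :
    IsTangentCurve Ψ Φ (fun t => γ (a + b - t)) (fun t => -α (a + b - t)) a b := by
  have hm : MapsTo (fun t => a + b - t) (Icc a b) (Icc a b) := fun t ht =>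
    ⟨by linarith [ht.2], by linarith [ht.1]⟩
  refine ⟨(h.continuousOn_covector.comp (by fun_prop) hm).neg, fun t ht => ?_⟩
  have h1 : HasDerivWithinAt (fun t : ℝ => a + b - t) (-1) (Icc a b) t := by
    simpa using (hasDerivWithinAt_id t (Icc a b)).const_sub (a + b)
  rw [map_neg, ← neg_one_smul ℝ]
  exact (h.hasDerivWithinAt _ (hm ht)).scomp t h1 hm

/-- Along the curve Φ · Ψ solves a linear equation whose coefficient, the divergence, is bounded on
the compact interval; Grönwall's inequality applies. -/
theorem pfaffian_eq_zero_of_left (hΛ : IsPoissonTensor Ψ Φ) (h : IsTangentCurve Ψ Φ γ α a b)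
    (h0 : Φ (γ a) ⬝ᵥ Ψ (γ a) = 0) {t : ℝ} (ht : t ∈ Icc a b) : Φ (γ t) ⬝ᵥ Ψ (γ t) = 0 := by
  have hc : ContinuousOn (fun t => divergence Ψ Φ (γ t) (α t)) (Icc a b) := by
    have h1 : ∀ v : R4, ContinuousOn (fun t => α t v) (Icc a b) := fun v =>
      h.continuousOn_covector.clm_apply continuousOn_const
    have h2 : ∀ β : R4 →L[ℝ] ℝ, ContinuousOn (fun t => divergence Ψ Φ (γ t) β) (Icc a b) := fun β =>
      (hΛ.continuous_divergence β).comp_continuousOn h.continuousOn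
    simp only [hΛ.divergence_eq (α _)]
    exact ((((h1 _).mul (h2 _)).add ((h1 _).mul (h2 _))).add ((h1 _).mul (h2 _))).add
      ((h1 _).mul (h2 _))
  obtain ⟨K, hK⟩ := isCompact_Icc.exists_bound_of_continuousOn hc
  have hd : ∀ x, HasFDerivAt (fun x => Φ x ⬝ᵥ Ψ x) (fderiv ℝ (fun x => Φ x ⬝ᵥ Ψ x) x) x := fun x =>
    (hΛ.contDiff_pfaffian.differentiable (by simp) x).hasFDerivAt
  refine eq_zero_of_abs_deriv_le_mul_abs_self_of_eq_zero_right (f := fun t => Φ (γ t) ⬝ᵥ Ψ (γ t))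
    (K := K) (hΛ.contDiff_pfaffian.continuous.comp_continuousOn h.continuousOn)
    (fun s hs => (hd (γ s)).comp_hasDerivWithinAt s (h.hasDerivWithinAt_Ici hs)) h0
    (fun s hs => ?_) t ht
  rw [hΛ.fderiv_pfaffian_sharp, norm_mul]
  exact mul_le_mul_of_nonneg_right (hK s (Ico_subset_Icc_self hs)) (norm_nonneg _)

theorem pfaffian_eq_zero (hΛ : IsPoissonTensor Ψ Φ) (h : IsTangentCurve Ψ Φ γ α a b) {s t : ℝ}
    (hs : s ∈ Icc a b) (ht : t ∈ Icc a b) (h0 : Φ (γ s) ⬝ᵥ Ψ (γ s) = 0) :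
    Φ (γ t) ⬝ᵥ Ψ (γ t) = 0 := by
  have ha : Φ (γ a) ⬝ᵥ Ψ (γ a) = 0 := by
    have h1 := (h.mono (Icc_subset_Icc_right hs.2)).reverse
    have := h1.pfaffian_eq_zero_of_left hΛ (by simpa using h0) ⟨hs.1, le_refl s⟩
    simpa using this
  exact h.pfaffian_eq_zero_of_left hΛ ha ht

/-- The velocity is (Λ^#(γ t) - Λ^#(γ a))(α t), at most a constant times ‖γ t - γ a‖ because `Λ^#`
is Lipschitz on the compact curve. -/
theorem eq_of_sharp_eq_zero (hΛ : IsPoissonTensor Ψ Φ) (h : IsTangentCurve Ψ Φ γ α a b)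
    (h0 : sharp Ψ Φ (γ a) = 0) {t : ℝ} (ht : t ∈ Icc a b) : γ t = γ a := by
  obtain ⟨C, hC⟩ := isCompact_Icc.exists_bound_of_continuousOn h.continuousOn_covector
  obtain ⟨K, hK⟩ := LocallyLipschitzOn.exists_lipschitzOnWith_of_compact
    (isCompact_Icc.image_of_continuousOn h.continuousOn)
    ((hΛ.contDiff_sharpL.of_le (by simp : (1 : WithTop ℕ∞) ≤ ∞)).locallyLipschitz.locallyLipschitzOn)
  have ha : a ∈ Icc a b := ⟨le_refl a, ht.1.trans ht.2⟩
  refine sub_eq_zero.1 (eq_zero_of_abs_deriv_le_mul_abs_self_of_eq_zero_right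
    (f := fun t => γ t - γ a) (K := K * C) (h.continuousOn.sub continuousOn_const)
    (fun s hs => (h.hasDerivWithinAt_Ici hs).sub_const _) (sub_self _) (fun s hs => ?_) t ht)
  have hs' := Ico_subset_Icc_self hs
  have h1 : sharp Ψ Φ (γ s) (α s) = (sharpL Ψ Φ (γ s) - sharpL Ψ Φ (γ a)) (α s) := by
    simp [sharpL_apply, h0]
  rw [h1]
  have h2 := hK.norm_sub_le (mem_image_of_mem γ hs') (mem_image_of_mem γ ha)
  calc _ ≤ ‖sharpL Ψ Φ (γ s) - sharpL Ψ Φ (γ a)‖ * ‖α s‖ := ContinuousLinearMap.le_opNorm _ _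
    _ ≤ (K * ‖γ s - γ a‖) * C := by
      gcongr
      exact hC s hs'
    _ = _ := by ring

end IsTangentCurve

end TangentCurves

/-! ### Leaves as equivalence classes; invariance of the rank -/

section Leaves

variable {Ψ Φ : R4 → R3}

theorem IsIntegralCurveOn.isTangentCurve {H : R4 → ℝ} {γ : ℝ → R4} {a b : ℝ} (hH : ContDiff ℝ ∞ H)
    (hγ : IsIntegralCurveOn γ (fun _ => hamiltonianField Ψ Φ H) (Icc a b)) :
    IsTangentCurve Ψ Φ γ (fun t => fderiv ℝ H (γ t)) a b :=
  ⟨(hH.continuous_fderiv (by simp)).comp_continuousOn hγ.continuousOn, hγ⟩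

theorem hamiltonianField_smul {H : R4 → ℝ} (hH : ContDiff ℝ ∞ H) (c : ℝ) (p : R4) :
    hamiltonianField Ψ Φ (fun x => c * H x) p = c • hamiltonianField Ψ Φ H p := by
  rw [hamiltonianField, fderiv_const_mul (hH.differentiable (by simp) p), map_smul]
  rfl

theorem HamiltonianArc.symm {p q : R4} (h : HamiltonianArc Ψ Φ p q) : HamiltonianArc Ψ Φ q p := by
  obtain ⟨H, γ, hH, h0, h1, hγ⟩ := h
  refine ⟨fun x => (-1) * H x, fun t => γ (0 + 1 - t), contDiff_const.mul hH, by simpa using h1,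
    by simpa using h0, fun t ht => ?_⟩
  have h2 := (IsIntegralCurveOn.isTangentCurve hH hγ).reverse.hasDerivWithinAt t ht
  beta_reduce at h2 ⊢
  rw [hamiltonianField_smul hH, hamiltonianField, neg_one_smul, ← map_neg]
  exact h2

theorem hamiltonianArc_of_mem_Icc {H : R4 → ℝ} {γ : ℝ → R4} (hH : ContDiff ℝ ∞ H)
    (hγ : IsIntegralCurveOn γ (fun _ => hamiltonianField Ψ Φ H) (Icc 0 1)) {t : ℝ}
    (ht : t ∈ Icc (0 : ℝ) 1) : HamiltonianArc Ψ Φ (γ 0) (γ t) := by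
  have hm : MapsTo (fun s => t * s) (Icc (0 : ℝ) 1) (Icc 0 1) := fun s hs =>
    ⟨mul_nonneg ht.1 hs.1, mul_le_one₀ ht.2 hs.1 hs.2⟩
  refine ⟨fun x => t * H x, fun s => γ (t * s), contDiff_const.mul hH, by simp, by simp,
    fun s hs => ?_⟩
  have h1 : HasDerivWithinAt (fun s : ℝ => t * s) t (Icc 0 1) s := by
    simpa using (hasDerivWithinAt_id s (Icc (0 : ℝ) 1)).const_mul t
  beta_reduce
  rw [hamiltonianField_smul hH]
  exact (hγ _ (hm hs)).scomp s h1 hm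

theorem mem_leaf_self (p : R4) : p ∈ leaf Ψ Φ p := Relation.ReflTransGen.refl

theorem HamiltonianArc.mem_leaf {p q r : R4} (h : HamiltonianArc Ψ Φ q r) (hq : q ∈ leaf Ψ Φ p) :
    r ∈ leaf Ψ Φ p :=
  Relation.ReflTransGen.tail hq h

theorem mem_leaf_symm {p q : R4} (h : q ∈ leaf Ψ Φ p) : p ∈ leaf Ψ Φ q := by
  induction h with
  | refl => exact mem_leaf_self p
  | tail _ h2 ih => exact Relation.ReflTransGen.head h2.symm ih

theorem leaf_eq_of_mem {p q : R4} (h : q ∈ leaf Ψ Φ p) : leaf Ψ Φ q = leaf Ψ Φ p := by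
  ext r
  exact ⟨fun hr => Relation.ReflTransGen.trans h hr,
    fun hr => Relation.ReflTransGen.trans (mem_leaf_symm h) hr⟩

theorem leaf_induction {p : R4} {P : R4 → Prop} (h0 : P p)
    (hstep : ∀ q r, q ∈ leaf Ψ Φ p → P q → HamiltonianArc Ψ Φ q r → P r) {q : R4}
    (hq : q ∈ leaf Ψ Φ p) : P q := by
  induction hq with
  | refl => exact h0
  | tail h1 h2 ih => exact hstep _ _ h1 ih h2

theorem HamiltonianArc.pfaffian_eq_zero_iff (hΛ : IsPoissonTensor Ψ Φ) {p q : R4}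
    (h : HamiltonianArc Ψ Φ p q) : Φ p ⬝ᵥ Ψ p = 0 ↔ Φ q ⬝ᵥ Ψ q = 0 := by
  obtain ⟨H, γ, hH, rfl, rfl, hγ⟩ := h
  have ht := IsIntegralCurveOn.isTangentCurve hH hγ
  exact ⟨ht.pfaffian_eq_zero hΛ (by simp) (by simp), ht.pfaffian_eq_zero hΛ (by simp) (by simp)⟩

/-- A change of sign would force a zero in between, and a zero at one time of the arc propagates to
all times. -/
theorem HamiltonianArc.pfaffian_mul_pos (hΛ : IsPoissonTensor Ψ Φ) {p q : R4}
    (h : HamiltonianArc Ψ Φ p q) (hp : Φ p ⬝ᵥ Ψ p ≠ 0) : 0 < (Φ p ⬝ᵥ Ψ p) * (Φ q ⬝ᵥ Ψ q) := by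
  obtain ⟨H, γ, hH, rfl, rfl, hγ⟩ := h
  have ht := IsIntegralCurveOn.isTangentCurve hH hγ
  by_contra! hneg
  have hc : ContinuousOn (fun t => (Φ (γ 0) ⬝ᵥ Ψ (γ 0)) * (Φ (γ t) ⬝ᵥ Ψ (γ t))) (Icc 0 1) :=
    continuousOn_const.mul (hΛ.contDiff_pfaffian.continuous.comp_continuousOn ht.continuousOn)
  obtain ⟨t, ht', h0⟩ := intermediate_value_Icc' zero_le_one hc
    (show (0 : ℝ) ∈ Icc _ _ from ⟨hneg, mul_self_nonneg _⟩)
  exact hp (ht.pfaffian_eq_zero hΛ ht' (by simp) ((mul_eq_zero.1 h0).resolve_left hp))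

theorem pfaffian_mul_pos_of_mem_leaf (hΛ : IsPoissonTensor Ψ Φ) {p q : R4} (hq : q ∈ leaf Ψ Φ p)
    (hp : Φ p ⬝ᵥ Ψ p ≠ 0) : 0 < (Φ p ⬝ᵥ Ψ p) * (Φ q ⬝ᵥ Ψ q) := by
  refine leaf_induction (P := fun q => 0 < (Φ p ⬝ᵥ Ψ p) * (Φ q ⬝ᵥ Ψ q)) (mul_self_pos.2 hp)
    (fun q r _ hq h => ?_) hq
  have h1 := h.pfaffian_mul_pos hΛ (right_ne_zero_of_mul hq.ne')
  have h2 : 0 < (Φ q ⬝ᵥ Ψ q) * (Φ q ⬝ᵥ Ψ q) := mul_self_pos.2 (right_ne_zero_of_mul hq.ne')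
  have h3 := mul_pos hq h1
  have h4 : 0 < ((Φ p ⬝ᵥ Ψ p) * (Φ r ⬝ᵥ Ψ r)) * ((Φ q ⬝ᵥ Ψ q) * (Φ q ⬝ᵥ Ψ q)) := by
    linarith
  exact (pos_iff_pos_of_mul_pos h4).2 h2

theorem pfaffian_eq_zero_of_mem_leaf (hΛ : IsPoissonTensor Ψ Φ) {p q : R4} (hq : q ∈ leaf Ψ Φ p)
    (hp : Φ p ⬝ᵥ Ψ p = 0) : Φ q ⬝ᵥ Ψ q = 0 :=
  leaf_induction (P := fun q => Φ q ⬝ᵥ Ψ q = 0) hp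
    (fun _ _ _ hq h => (h.pfaffian_eq_zero_iff hΛ).1 hq) hq

theorem leaf_eq_singleton (hΛ : IsPoissonTensor Ψ Φ) {p : R4} (hp : sharp Ψ Φ p = 0) :
    leaf Ψ Φ p = {p} := by
  refine Subset.antisymm (fun q hq => ?_) (singleton_subset_iff.2 (mem_leaf_self p))
  refine leaf_induction (P := fun q => q ∈ ({p} : Set R4)) (mem_singleton p)
    (fun q r _ hq h => ?_) hq
  rw [mem_singleton_iff] at hq ⊢
  subst hq
  obtain ⟨H, γ, hH, rfl, rfl, hγ⟩ := h
  exact (IsIntegralCurveOn.isTangentCurve hH hγ).eq_of_sharp_eq_zero hΛ hp (by simp)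

theorem norm_sq_ne_zero_of_mem_leaf (hΛ : IsPoissonTensor Ψ Φ) {p q : R4} (hq : q ∈ leaf Ψ Φ p)
    (hp : Φ p ⬝ᵥ Φ p + Ψ p ⬝ᵥ Ψ p ≠ 0) : Φ q ⬝ᵥ Φ q + Ψ q ⬝ᵥ Ψ q ≠ 0 := by
  intro h0
  have h1 := leaf_eq_singleton hΛ (sharp_eq_zero h0)
  have h2 := mem_leaf_symm hq
  rw [h1, mem_singleton_iff] at h2
  exact hp (h2 ▸ h0)

end Leaves

/-! ### Construction of Hamiltonian arcs; leaves of rank four -/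

section Arcs

variable {Ψ Φ : R4 → R3}

theorem contDiff_bump_smul {E : Type*} [NormedAddCommGroup E] [NormedSpace ℝ E] {ε : ℝ}
    {c : ℝ} (χ : ContDiffBump c) (hχ : χ.rOut < ε) {f : ℝ → E}
    (hf : ContDiffOn ℝ ∞ f (Metric.ball c ε)) : ContDiff ℝ ∞ fun t => χ t • f t := by
  rw [contDiff_iff_contDiffAt]
  intro t
  by_cases ht : t ∈ Metric.ball c ε
  · exact χ.contDiff.contDiffAt.smul (hf.contDiffAt (Metric.isOpen_ball.mem_nhds ht))
  · have h1 : t ∉ tsupport χ := by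
      rw [χ.tsupport_eq]
      exact fun h => ht (Metric.closedBall_subset_ball hχ h)
    have h2 : (fun t => χ t • f t) =ᶠ[nhds t] fun _ => 0 := by
      filter_upwards [notMem_tsupport_iff_eventuallyEq.1 h1] with s hs
      simp [hs]
    exact contDiffAt_const.congr_of_eventuallyEq h2

/-- A smooth curve with velocity `Λ^#(α)` on which some smooth function restricts to the parameter
is an integral curve of a Hamiltonian field. -/
theorem hamiltonianArc_of_transversal {γ : ℝ → R4} {α : ℝ → R4 →L[ℝ] ℝ} {ρ : R4 → ℝ} {ε : ℝ}
    (hε : 0 < ε) (hγ : ContDiffOn ℝ ∞ γ (Ioo (-ε) (1 + ε)))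
    (hα : ContDiffOn ℝ ∞ α (Ioo (-ε) (1 + ε))) (hρ : ContDiff ℝ ∞ ρ)
    (hργ : ∀ t ∈ Icc (0 : ℝ) 1, ρ (γ t) = t)
    (hder : ∀ t ∈ Icc (0 : ℝ) 1, HasDerivAt γ (sharp Ψ Φ (γ t) (α t)) t) :
    HamiltonianArc Ψ Φ (γ 0) (γ 1) := by
  have hball : Ioo (-ε) (1 + ε) = Metric.ball (1 / 2 : ℝ) (1 / 2 + ε) := by
    rw [Real.ball_eq_Ioo]
    congr 1 <;> ring
  rw [hball] at hγ hα
  -- The cutoff is 1 on [-ε/3, 1 + ε/3] and supported in [-ε/2, 1 + ε/2], so the Hamiltonian below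
  -- is smooth on all of ℝ⁴.
  let χ : ContDiffBump (1 / 2 : ℝ) :=
    ⟨1 / 2 + ε / 3, 1 / 2 + ε / 2, by linarith, by linarith⟩
  have hA : ContDiff ℝ ∞ fun t => χ t • α t :=
    contDiff_bump_smul χ (show 1 / 2 + ε / 2 < 1 / 2 + ε by linarith) hα
  have hc : ContDiff ℝ ∞ fun t => χ t • α t (γ t) :=
    contDiff_bump_smul χ (show 1 / 2 + ε / 2 < 1 / 2 + ε by linarith) (hα.clm_apply hγ)
  -- Up to the cutoff, H(x) = α(ρ(x))(x - γ(ρ(x))). At γ(t) its differential is α(t) plus a multiple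
  -- of dρ with coefficient α'(γ) - (α(γ))' = -α(Λ^#(α)) = 0.
  refine ⟨fun x => (χ (ρ x) • α (ρ x)) x - χ (ρ x) • α (ρ x) (γ (ρ x)), γ, ?_, rfl, rfl,
    fun t ht => ?_⟩
  · exact ((hA.comp hρ).clm_apply contDiff_id).sub (hc.comp hρ)
  · have hχ : (χ : ℝ → ℝ) =ᶠ[nhds t] fun _ => 1 := by
      have : t ∈ Metric.ball (1 / 2 : ℝ) χ.rIn := by
        change t ∈ Metric.ball (1 / 2 : ℝ) (1 / 2 + ε / 3)
        rw [Real.ball_eq_Ioo]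
        exact ⟨by linarith [ht.1], by linarith [ht.2]⟩
      filter_upwards [Metric.isOpen_ball.mem_nhds this] with s hs
      exact χ.one_of_mem_closedBall (Metric.ball_subset_closedBall hs)
    have htb : t ∈ Metric.ball (1 / 2 : ℝ) (1 / 2 + ε) := by
      rw [← hball]
      exact ⟨by linarith [ht.1], by linarith [ht.2]⟩
    have hα' := ((hα.contDiffAt (Metric.isOpen_ball.mem_nhds htb)).differentiableAt
      (by simp)).hasDerivAt
    have hA' : HasDerivAt (fun t => χ t • α t) (deriv α t) t :=
      hα'.congr_of_eventuallyEq (hχ.mono fun s hs => by simp [hs])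
    have hc' : HasDerivAt (fun t => χ t • α t (γ t)) (deriv α t (γ t)) t := by
      have h1 := hα'.clm_apply (hder t ht)
      rw [apply_sharp_self, add_zero] at h1
      exact h1.congr_of_eventuallyEq (hχ.mono fun s hs => by simp [hs])
    have hρ' := (hρ.differentiable (by simp) (γ t)).hasFDerivAt
    have e1 : ρ (γ t) = t := hργ t ht
    have e2 : χ t = 1 := hχ.self_of_nhds
    rw [← e1] at hA' hc'
    have h1 := hA'.hasFDerivAt.comp (γ t) hρ'
    have h2 := hc'.hasFDerivAt.comp (γ t) hρ'
    have h3 := (h1.clm_apply (hasFDerivAt_id (γ t))).sub h2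
    have h4 : hamiltonianField Ψ Φ
        (fun x => (χ (ρ x) • α (ρ x)) x - χ (ρ x) • α (ρ x) (γ (ρ x))) (γ t)
        = sharp Ψ Φ (γ t) (α t) := by
      rw [hamiltonianField]
      congr 1
      refine h3.fderiv.trans ?_
      rw [e1]
      refine ContinuousLinearMap.ext fun w => ?_
      simp [e1, e2]
    beta_reduce
    rw [h4]
    exact (hder t ht).hasDerivWithinAt

theorem IsPoissonTensor.contDiffOn_flat (hΛ : IsPoissonTensor Ψ Φ) {v : R4} {γ : ℝ → R4}
    {s : Set ℝ} (hγ : ContDiffOn ℝ ∞ γ s) (hs : ∀ t ∈ s, Φ (γ t) ⬝ᵥ Ψ (γ t) ≠ 0) :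
    ContDiffOn ℝ ∞ (fun t => flat Ψ Φ (γ t) v) s := by
  have hΦ := fun i => (hΛ.contDiff_Φ_apply i).comp_contDiffOn hγ
  have hΨ := fun i => (hΛ.contDiff_Ψ_apply i).comp_contDiffOn hγ
  have hF := (hΛ.contDiff_pfaffian.comp_contDiffOn hγ).inv hs
  refine hF.smul ?_
  simp only [covec, cross_apply, dotProduct, Fin.sum_univ_three, Pi.add_apply,
    Pi.smul_apply, smul_eq_mul, Matrix.cons_val_zero, Matrix.cons_val_one, Matrix.cons_val]
  have h1 : ∀ (c a b : ℝ) (i j k : Fin 3) (δ : R4 →L[ℝ] ℝ),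
      ContDiffOn ℝ ∞ (fun t => (c * Ψ (γ t) i + (a * Φ (γ t) j - b * Φ (γ t) k)) • δ) s :=
    fun c a b i j k δ => ((contDiffOn_const.mul (hΨ i)).add
      ((contDiffOn_const.mul (hΦ j)).sub (contDiffOn_const.mul (hΦ k)))).smul contDiffOn_const
  refine (((h1 _ _ _ _ _ _ _).add (h1 _ _ _ _ _ _ _)).add (h1 _ _ _ _ _ _ _)).add ?_
  exact (((contDiffOn_const.mul (hΨ 0)).add (contDiffOn_const.mul (hΨ 1))).add
    (contDiffOn_const.mul (hΨ 2))).neg.smul contDiffOn_const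

/-- Points of a ball on which `Λ` has rank four are joined to the centre by Hamiltonian arcs. -/
theorem mem_leaf_of_mem_ball (hΛ : IsPoissonTensor Ψ Φ) {p q : R4} {r : ℝ}
    (hr : ∀ x ∈ Metric.ball p r, Φ x ⬝ᵥ Ψ x ≠ 0) (hq : q ∈ Metric.ball p r) :
    q ∈ leaf Ψ Φ p := by
  by_cases hpq : q = p
  · exact hpq ▸ mem_leaf_self _
  have hv : q - p ≠ 0 := sub_ne_zero.2 hpq
  have hv' : 0 < ‖q - p‖ := norm_pos_iff.2 hv
  have hvr : ‖q - p‖ < r := by rwa [← dist_eq_norm]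
  obtain ⟨f, hf⟩ := SeparatingDual.exists_eq_one (R := ℝ) hv
  let γ : ℝ → R4 := fun t => p + t • (q - p)
  -- The segment from `p` to `q` can be prolonged inside the ball by this amount at both ends.
  have hε : 0 < r / ‖q - p‖ - 1 := by
    rw [sub_pos, one_lt_div hv']
    exact hvr
  have hγ : ContDiff ℝ ∞ γ := contDiff_const.add (contDiff_id.smul contDiff_const)
  have hmem : ∀ t ∈ Ioo (-(r / ‖q - p‖ - 1)) (1 + (r / ‖q - p‖ - 1)), γ t ∈ Metric.ball p r := by
    intro t ht
    have h1 : |t| < r / ‖q - p‖ := abs_lt.2 ⟨by linarith [ht.1], by linarith [ht.2]⟩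
    rw [lt_div_iff₀ hv'] at h1
    simpa [γ, norm_smul] using h1
  have harc : HamiltonianArc Ψ Φ (γ 0) (γ 1) := by
    refine hamiltonianArc_of_transversal (α := fun t => flat Ψ Φ (γ t) (q - p))
      (ρ := fun x => f (x - p)) hε hγ.contDiffOn
      (hΛ.contDiffOn_flat hγ.contDiffOn fun t ht => hr _ (hmem t ht))
      (f.contDiff.comp (contDiff_id.sub contDiff_const)) (fun t _ => by simp [γ, hf, -map_sub])
      (fun t ht => ?_)
    rw [sharp_flat (hr _ (hmem t ⟨by linarith [ht.1], by linarith [ht.2]⟩))]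
    have h1 := ((hasDerivAt_id t).smul_const (q - p)).const_add p
    rw [one_smul] at h1
    exact h1
  have h0 : γ 0 = p := by simp [γ]
  have h1 : γ 1 = q := by simp [γ]
  rw [h0, h1] at harc
  exact harc.mem_leaf (mem_leaf_self p)

theorem isOpen_leaf (hΛ : IsPoissonTensor Ψ Φ) {p : R4} (hp : Φ p ⬝ᵥ Ψ p ≠ 0) :
    IsOpen (leaf Ψ Φ p) := by
  rw [Metric.isOpen_iff]
  intro q hq
  have hq' : Φ q ⬝ᵥ Ψ q ≠ 0 := right_ne_zero_of_mul (pfaffian_mul_pos_of_mem_leaf hΛ hq hp).ne'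
  obtain ⟨r, hr, hball⟩ := Metric.isOpen_iff.1 hΛ.isOpen_pfaffian_ne_zero q hq'
  refine ⟨r, hr, fun x hx => ?_⟩
  rw [← leaf_eq_of_mem hq]
  exact mem_leaf_of_mem_ball hΛ hball hx

/-- A leaf contained in a set on which `Λ` has rank four is a connected component of that set. -/
theorem leaf_eq_connectedComponentIn (hΛ : IsPoissonTensor Ψ Φ) {p : R4} {S : Set R4}
    (hS : ∀ x ∈ S, Φ x ⬝ᵥ Ψ x ≠ 0) (hp : leaf Ψ Φ p ⊆ S) :
    leaf Ψ Φ p = connectedComponentIn S p := by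
  have hpS : p ∈ S := hp (mem_leaf_self p)
  apply Subset.antisymm
  · intro q hq
    refine leaf_induction (P := fun q => q ∈ connectedComponentIn S p)
      (mem_connectedComponentIn hpS) (fun q r hqp hq h => ?_) hq
    obtain ⟨H, γ, hH, rfl, rfl, hγ⟩ := h
    rw [connectedComponentIn_eq hq]
    refine ((isPreconnected_Icc (a := (0 : ℝ)) (b := 1)).image γ
      hγ.continuousOn).subset_connectedComponentIn (mem_image_of_mem γ (by simp)) ?_
      (mem_image_of_mem γ (by simp))
    rintro _ ⟨t, ht, rfl⟩
    exact hp ((hamiltonianArc_of_mem_Icc hH hγ ht).mem_leaf hqp)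
  -- The rest of `S` is covered by other leaves, which are open too; a connected subset of `S`
  -- meeting this leaf cannot leave it.
  · refine isPreconnected_connectedComponentIn.subset_left_of_subset_union
      (v := ⋃ q ∈ S \ leaf Ψ Φ p, leaf Ψ Φ q) (isOpen_leaf hΛ (hS p hpS))
      (isOpen_biUnion fun q hq => isOpen_leaf hΛ (hS q hq.1)) ?_ ?_
      ⟨p, mem_connectedComponentIn hpS, mem_leaf_self p⟩
    · refine disjoint_iUnion₂_right.2 fun q hq => disjoint_left.2 fun x hx hxq => hq.2 ?_
      rw [← leaf_eq_of_mem hx, leaf_eq_of_mem hxq]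
      exact mem_leaf_self q
    · intro q hq
      by_cases hqp : q ∈ leaf Ψ Φ p
      · exact Or.inl hqp
      · exact Or.inr (mem_iUnion₂.2
          ⟨q, ⟨connectedComponentIn_subset S p hq, hqp⟩, mem_leaf_self q⟩)

theorem leaf_subset_Splus (hΛ : IsPoissonTensor Ψ Φ) {p : R4} (hp : p ∈ Splus Ψ Φ) :
    leaf Ψ Φ p ⊆ Splus Ψ Φ := fun _ hq =>
  (pos_iff_pos_of_mul_pos (pfaffian_mul_pos_of_mem_leaf hΛ hq (ne_of_gt hp))).1 hp

theorem leaf_subset_Sminus (hΛ : IsPoissonTensor Ψ Φ) {p : R4} (hp : p ∈ Sminus Ψ Φ) :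
    leaf Ψ Φ p ⊆ Sminus Ψ Φ := fun _ hq =>
  (neg_iff_neg_of_mul_pos (pfaffian_mul_pos_of_mem_leaf hΛ hq (ne_of_lt hp))).1 hp

theorem leaf_eq_connectedComponentIn_Splus (hΛ : IsPoissonTensor Ψ Φ) {p : R4}
    (hp : p ∈ Splus Ψ Φ) : leaf Ψ Φ p = connectedComponentIn (Splus Ψ Φ) p :=
  leaf_eq_connectedComponentIn hΛ (fun _ hx => ne_of_gt hx) (leaf_subset_Splus hΛ hp)

theorem leaf_eq_connectedComponentIn_Sminus (hΛ : IsPoissonTensor Ψ Φ) {p : R4}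
    (hp : p ∈ Sminus Ψ Φ) : leaf Ψ Φ p = connectedComponentIn (Sminus Ψ Φ) p :=
  leaf_eq_connectedComponentIn hΛ (fun _ hx => ne_of_lt hx) (leaf_subset_Sminus hΛ hp)

end Arcs

end PoissonR4

namespace PoissonR4

open Set Metric
open scoped NNReal Topology

/-! ### Frobenius' theorem along an invariant set -/

section Frobenius

variable {E W : Type*} [NormedAddCommGroup E] [NormedSpace ℝ E] [NormedAddCommGroup W]
  [NormedSpace ℝ W]

/-- The Picard-Lindelöf theorem, with the solution staying in the ball on which the vector field
is controlled. -/
theorem exists_integralCurve_mem_closedBall [CompleteSpace E] {f : ℝ → E → E} {tmin tmax : ℝ}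
    {t₀ : Icc tmin tmax} {x₀ x : E} {a r L K : ℝ≥0} (hf : IsPicardLindelof f t₀ x₀ a r L K)
    (hx : x ∈ closedBall x₀ r) :
    ∃ γ : ℝ → E, γ t₀ = x ∧ (∀ t, γ t ∈ closedBall x₀ a) ∧
      ∀ t ∈ Icc tmin tmax, HasDerivWithinAt γ (f t (γ t)) (Icc tmin tmax) t := by
  obtain ⟨γ, hγ⟩ := ODE.FunSpace.exists_isFixedPt_next hf hx
  refine ⟨γ.compProj, by rw [ODE.FunSpace.compProj_val, ← hγ, ODE.FunSpace.next_apply₀],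
    fun _ => γ.compProj_mem_closedBall hf.mul_max_le, fun t ht ↦ ?_⟩
  apply ODE.hasDerivWithinAt_picard_Icc t₀.2 hf.continuousOn_uncurry
    γ.continuous_compProj.continuousOn (fun _ ht' ↦ γ.compProj_mem_closedBall hf.mul_max_le)
    x ht |>.congr_of_mem _ ht
  intro t' ht'
  nth_rw 1 [← hγ]
  rw [ODE.FunSpace.compProj_of_mem ht', ODE.FunSpace.next_apply]

theorem norm_le_exp_mul_of_norm_deriv_le {f f' : ℝ → E} {K ε : ℝ} (hK : 0 ≤ K) (hε : 0 ≤ ε)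
    (hf : ContinuousOn f (Icc 0 1)) (hf' : ∀ t ∈ Ico (0 : ℝ) 1, HasDerivWithinAt f (f' t) (Ici t) t)
    (h0 : f 0 = 0) (bound : ∀ t ∈ Ico (0 : ℝ) 1, ‖f' t‖ ≤ K * ‖f t‖ + ε) {t : ℝ}
    (ht : t ∈ Icc (0 : ℝ) 1) : ‖f t‖ ≤ Real.exp (K + 1) * ε := by
  -- Replacing `K` by `K + 1` excludes the degenerate Grönwall bound, and dividing by `K + 1` only
  -- decreases the estimate.
  have h1 := norm_le_gronwallBound_of_norm_deriv_right_le (δ := 0) (K := K + 1) (ε := ε) hf hf'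
    (by simp [h0]) (fun s hs => (bound s hs).trans (by nlinarith [norm_nonneg (f s)])) t ht
  refine h1.trans ?_
  have hK' : K + 1 ≠ 0 := by positivity
  rw [gronwallBound_of_K_ne_0 hK']
  beta_reduce
  rw [zero_mul, zero_add, sub_zero, mul_comm]
  refine mul_le_mul ?_ (div_le_self hε (by linarith)) (by positivity) (by positivity)
  have : Real.exp ((K + 1) * t) ≤ Real.exp (K + 1) :=
    Real.exp_le_exp.2 (mul_le_of_le_one_right (by positivity) ht.2)
  linarith

theorem exists_taylor_bounds [FiniteDimensional ℝ E] {G : Type*} [NormedAddCommGroup G]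
    [NormedSpace ℝ G] {V : E → G} {O : Set E} (hO : IsOpen O) (hV : ContDiffOn ℝ ∞ V O) {p : E}
    {ρ : ℝ} (hρ : closedBall p ρ ⊆ O) :
    ∃ C K₁ L : ℝ, 0 ≤ C ∧ 0 ≤ K₁ ∧ 0 ≤ L ∧ ∃ K : ℝ≥0, LipschitzOnWith K V (closedBall p ρ) ∧
      (∀ x ∈ closedBall p ρ, ‖V x‖ ≤ C) ∧ (∀ x ∈ closedBall p ρ, ‖fderiv ℝ V x‖ ≤ K₁) ∧
      ∀ x ∈ closedBall p ρ, ∀ y ∈ closedBall p ρ,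
        ‖V y - V x - fderiv ℝ V x (y - x)‖ ≤ L * ‖y - x‖ ^ 2 := by
  have hcpt : IsCompact (closedBall p ρ) := isCompact_closedBall p ρ
  have hconv : Convex ℝ (closedBall p ρ) := convex_closedBall p ρ
  have hdV : ContDiffOn ℝ ∞ (fderiv ℝ V) O := hV.fderiv_of_isOpen hO (by simp)
  obtain ⟨C, hC⟩ := hcpt.exists_bound_of_continuousOn (hV.continuousOn.mono hρ)
  obtain ⟨K₁, hK₁⟩ := hcpt.exists_bound_of_continuousOn (hdV.continuousOn.mono hρ)
  obtain ⟨K, hK⟩ := (hV.mono hρ).exists_lipschitzOnWith (by simp) hconv hcpt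
  obtain ⟨L, hL⟩ := (hdV.mono hρ).exists_lipschitzOnWith (by simp) hconv hcpt
  refine ⟨max C 0, max K₁ 0, L, le_max_right _ _, le_max_right _ _, L.2, K, hK,
    fun x hx => (hC x hx).trans (le_max_left _ _), fun x hx => (hK₁ x hx).trans (le_max_left _ _),
    fun x hx y hy => ?_⟩
  -- On the part of the ball within ‖y - x‖ of `x`, the derivative of `V` differs from its value at
  -- `x` by at most L‖y - x‖; the mean value inequality then gives a quadratic remainder.
  have h1 := (hconv.inter (convex_closedBall x ‖y - x‖)).norm_image_sub_le_of_norm_fderiv_le'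
    (f := V) (φ := fderiv ℝ V x) (C := L * ‖y - x‖)
    (fun z hz => (hV.contDiffAt (hO.mem_nhds (hρ hz.1))).differentiableAt (by simp))
    (fun z hz => (hL.norm_sub_le hz.1 hx).trans (by
      have := mem_closedBall_iff_norm.1 hz.2
      gcongr))
    ⟨hx, by simp⟩ ⟨hy, by simp [dist_eq_norm]⟩
  linarith [sq ‖y - x‖]

/-- Frobenius' theorem along an invariant set: a field `V` of linear injections, symmetric in the
sense of integrability at the points of the invariant set `Z` only, has an integral
submanifold through `p ∈ Z`, presented as the image of the exponential map. -/
theorem exists_hasFDerivAt_eq_of_symmetric [FiniteDimensional ℝ E] {V : E → W →L[ℝ] E} {O : Set E}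
    (hO : IsOpen O) (hV : ContDiffOn ℝ ∞ V O) {Z : Set E} {p : E} (hp : p ∈ O)
    (hZ : ∀ (γ : ℝ → E) (w : W), γ 0 = p → (∀ t ∈ Icc (0 : ℝ) 1, γ t ∈ O) →
      (∀ t ∈ Icc (0 : ℝ) 1, HasDerivWithinAt γ (V (γ t) w) (Icc 0 1) t) →
      ∀ t ∈ Icc (0 : ℝ) 1, γ t ∈ Z)
    (hsymm : ∀ x ∈ O, x ∈ Z → ∀ v w, fderiv ℝ V x (V x v) w = fderiv ℝ V x (V x w) v) :
    ∃ δ > 0, ∃ σ : W → E, σ 0 = p ∧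
      ∀ w ∈ ball (0 : W) δ, σ w ∈ O ∧ σ w ∈ Z ∧ HasFDerivAt σ (V (σ w)) w := by
  have : CompleteSpace E := FiniteDimensional.complete ℝ E
  obtain ⟨ρ, hρ, hB⟩ := nhds_basis_closedBall.mem_iff.1 (hO.mem_nhds hp)
  obtain ⟨C, K₁, L, hC0, hK₁0, hL0, K, hK, hC, hK₁, hL⟩ := exists_taylor_bounds hO hV hB
  -- For ‖w‖ < δ the speed is at most Cδ ≤ ρ, so solutions stay in the ball up to time 1.
  set δ : ℝ := ρ / (C + 1) with hδ
  have hδ0 : 0 < δ := by positivity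
  have hCδ : C * δ ≤ ρ := by
    rw [hδ, mul_div_assoc', div_le_iff₀ (by positivity)]
    nlinarith
  have hex : ∀ w : W, ∃ γ : ℝ → E, w ∈ ball (0 : W) δ → γ 0 = p ∧
      (∀ t, γ t ∈ closedBall p ρ) ∧
      ∀ t ∈ Icc (0 : ℝ) 1, HasDerivWithinAt γ (V (γ t) w) (Icc 0 1) t := by
    intro w
    by_cases hw : w ∈ ball (0 : W) δ
    swap
    · exact ⟨fun _ => p, fun h => absurd h hw⟩
    have hwδ : ‖w‖ < δ := by simpa using hw
    have hpl : IsPicardLindelof (fun _ x => V x w) (tmin := 0) (tmax := 1) ⟨0, by simp⟩ p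
        ⟨ρ, hρ.le⟩ 0 ⟨C * δ, by positivity⟩ (K * ‖w‖₊) := by
      refine IsPicardLindelof.of_time_independent (f := fun x => V x w) (fun x hx => ?_) ?_ ?_
      · refine ((V x).le_opNorm w).trans ?_
        exact mul_le_mul (hC x hx) hwδ.le (norm_nonneg _) hC0
      · refine LipschitzOnWith.of_dist_le_mul fun x hx y hy => ?_
        rw [dist_eq_norm, ← sub_apply]
        refine ((V x - V y).le_opNorm w).trans ?_
        have h1 := hK.dist_le_mul x hx y hy
        rw [dist_eq_norm] at h1
        calc _ ≤ (K * dist x y) * ‖w‖ := by gcongr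
          _ = _ := by
            simp only [NNReal.coe_mul, coe_nnnorm]
            ring
      · have h1 : C * δ * max (1 - 0) (0 - 0) ≤ ρ - 0 := by simpa using hCδ
        exact h1
    obtain ⟨γ, h0, hmem, hder⟩ := exists_integralCurve_mem_closedBall hpl (x := p) (by simp)
    exact ⟨γ, fun _ => ⟨h0, hmem, hder⟩⟩
  choose Γ hΓ using hex
  have hcont : ∀ w ∈ ball (0 : W) δ, ContinuousOn (Γ w) (Icc 0 1) := fun w hw t ht =>
    ((hΓ w hw).2.2 t ht).continuousWithinAt
  have hderR : ∀ w ∈ ball (0 : W) δ, ∀ t ∈ Ico (0 : ℝ) 1,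
      HasDerivWithinAt (Γ w) (V (Γ w t) w) (Ici t) t := fun w hw t ht =>
    ((hΓ w hw).2.2 t (Ico_subset_Icc_self ht)).mono_of_mem_nhdsWithin (Icc_mem_nhdsGE_of_mem ht)
  have hmemZ : ∀ w ∈ ball (0 : W) δ, ∀ t ∈ Icc (0 : ℝ) 1, Γ w t ∈ Z := fun w hw =>
    hZ (Γ w) w (hΓ w hw).1 (fun t _ => hB ((hΓ w hw).2.1 t)) (hΓ w hw).2.2
  have h01 : (1 : ℝ) ∈ Icc (0 : ℝ) 1 := by simp
  refine ⟨δ, hδ0, fun w => Γ w 1, ?_, fun z hz => ⟨hB ((hΓ z hz).2.1 1), hmemZ z hz 1 h01, ?_⟩⟩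
  · have hz : (0 : W) ∈ ball (0 : W) δ := by simpa using hδ0
    have h1 := constant_of_has_deriv_right_zero (hcont 0 hz)
      (fun t ht => by simpa using hderR 0 hz t ht) 1 h01
    exact h1.trans (hΓ 0 hz).1
  · have hzδ : ‖z‖ ≤ δ := by simpa using (mem_ball.1 hz).le
    set G : ℝ := Real.exp (K * δ + 1) * C with hG
    have hG0 : 0 ≤ G := by positivity
    have key : ∀ w, z + w ∈ ball (0 : W) δ →
        ‖Γ (z + w) 1 - Γ z 1 - V (Γ z 1) w‖ ≤
          (Real.exp (K₁ * δ + 1) * (L * G ^ 2 * δ + K * G)) * ‖w‖ ^ 2 := by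
      intro w hw
      have hwδ : ‖z + w‖ ≤ δ := by simpa using (mem_ball.1 hw).le
      -- First-order estimate: solutions depend on the parameter in a Lipschitz way.
      have hD : ∀ t ∈ Icc (0 : ℝ) 1, ‖Γ (z + w) t - Γ z t‖ ≤ G * ‖w‖ := by
        intro t ht
        rw [hG, mul_assoc]
        refine norm_le_exp_mul_of_norm_deriv_le (f := fun t => Γ (z + w) t - Γ z t)
          (by positivity) (by positivity)
          ((hcont _ hw).sub (hcont _ hz)) (fun s hs => (hderR _ hw s hs).sub (hderR _ hz s hs))
          (by simp [(hΓ _ hw).1, (hΓ _ hz).1]) (fun s hs => ?_) ht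
        have e : V (Γ (z + w) s) (z + w) - V (Γ z s) z
            = (V (Γ (z + w) s) - V (Γ z s)) (z + w) + V (Γ z s) w := by
          simp only [map_add, sub_apply]
          abel
        rw [e]
        refine (norm_add_le _ _).trans (add_le_add ?_ ?_)
        · calc _ ≤ ‖V (Γ (z + w) s) - V (Γ z s)‖ * ‖z + w‖ := ContinuousLinearMap.le_opNorm _ _
            _ ≤ (K * ‖Γ (z + w) s - Γ z s‖) * δ := by
              gcongr
              exact hK.norm_sub_le ((hΓ _ hw).2.1 s) ((hΓ _ hz).2.1 s)
            _ = _ := by ring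
        · exact ((V (Γ z s)).le_opNorm w).trans (by
            gcongr
            exact hC _ ((hΓ _ hz).2.1 s))
      have hVd : ∀ s, HasFDerivAt V (fderiv ℝ V (Γ z s)) (Γ z s) := fun s =>
        ((hV.contDiffAt (hO.mem_nhds (hB ((hΓ _ hz).2.1 s)))).differentiableAt
          (by simp)).hasFDerivAt
      -- The remainder R(t) = Γ(z + w)(t) - Γ(z)(t) - t V(Γ(z)(t)) w satisfies R(0) = 0 and ‖R'‖ ≤
      -- K₁δ‖R‖ + O(‖w‖²); hence R(1) = O(‖w‖²), which is differentiability at `z`.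
      have hR := norm_le_exp_mul_of_norm_deriv_le
        (f := fun t => Γ (z + w) t - Γ z t - t • V (Γ z t) w)
        (f' := fun t => V (Γ (z + w) t) (z + w) - V (Γ z t) z
          - (t • fderiv ℝ V (Γ z t) (V (Γ z t) z) w + (1 : ℝ) • V (Γ z t) w))
        (K := K₁ * δ) (ε := (L * G ^ 2 * δ + K * G) * ‖w‖ ^ 2) (by positivity) (by positivity)
        ?_ ?_ (by simp [(hΓ _ hw).1, (hΓ _ hz).1]) (fun s hs => ?_) h01
      · rw [← mul_assoc, one_smul] at hR
        exact hR
      · refine ((hcont _ hw).sub (hcont _ hz)).sub (continuousOn_id.smul ?_)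
        exact ((hV.continuousOn.comp (hcont _ hz)
          fun t _ => hB ((hΓ _ hz).2.1 t)).clm_apply continuousOn_const)
      · intro t ht
        have h1 := (hVd t).comp_hasDerivWithinAt t (hderR _ hz t ht)
        have h2 := h1.clm_apply (hasDerivWithinAt_const t (Ici t) w)
        rw [map_zero, add_zero] at h2
        exact ((hderR _ hw t ht).sub (hderR _ hz t ht)).sub
          ((hasDerivWithinAt_id t (Ici t)).smul h2)
      · have hs' := Ico_subset_Icc_self hs
        have hDs := hD s hs'
        set y := Γ (z + w) s with hy
        set x := Γ z s with hx
        have hyB : y ∈ closedBall p ρ := (hΓ _ hw).2.1 s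
        have hxB : x ∈ closedBall p ρ := (hΓ _ hz).2.1 s
        -- Integrability is needed only here, on the unperturbed curve, which lies in `Z`.
        -- Exchanging `z` and `w` turns the unwanted term into a derivative of `V` in the direction
        -- V(x) w, which combines with the Taylor term into the derivative in the direction R(s).
        rw [hsymm x (hB hxB) (hmemZ _ hz s hs') z w]
        have e : V y (z + w) - V x z - (s • fderiv ℝ V x (V x w) z + (1 : ℝ) • V x w)
            = (V y - V x - fderiv ℝ V x (y - x)) z + fderiv ℝ V x (y - x - s • V x w) z
              + (V y - V x) w := by
          simp only [map_add, map_sub, map_smul, sub_apply, one_smul,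
            FunLike.coe_smul, Pi.smul_apply]
          abel
        rw [e]
        have b1 : ‖(V y - V x - fderiv ℝ V x (y - x)) z‖ ≤ (L * (G * ‖w‖) ^ 2) * δ := by
          refine (ContinuousLinearMap.le_opNorm _ _).trans ?_
          gcongr
          exact (hL x hxB y hyB).trans (by gcongr)
        have b2 : ‖fderiv ℝ V x (y - x - s • V x w) z‖ ≤ (K₁ * ‖y - x - s • V x w‖) * δ := by
          refine (ContinuousLinearMap.le_opNorm _ _).trans ?_
          gcongr
          exact (ContinuousLinearMap.le_opNorm _ _).trans (by
            gcongr
            exact hK₁ x hxB)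
        have b3 : ‖(V y - V x) w‖ ≤ (K * (G * ‖w‖)) * ‖w‖ := by
          refine (ContinuousLinearMap.le_opNorm _ _).trans ?_
          gcongr
          exact (hK.norm_sub_le hyB hxB).trans (by gcongr)
        calc _ ≤ _ := norm_add₃_le
          _ ≤ _ := add_le_add (add_le_add b1 b2) b3
          _ = _ := by ring
    rw [hasFDerivAt_iff_isLittleO_nhds_zero]
    refine Asymptotics.IsBigO.trans_isLittleO (g := fun w : W => ‖w‖ ^ 2) ?_
      (Asymptotics.isLittleO_norm_pow_id one_lt_two)
    refine Asymptotics.IsBigO.of_bound (Real.exp (K₁ * δ + 1) * (L * G ^ 2 * δ + K * G)) ?_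
    have hnear : ∀ᶠ w in 𝓝 (0 : W), z + w ∈ ball (0 : W) δ :=
      (continuous_const.add continuous_id).continuousAt.eventually_mem
        (isOpen_ball.mem_nhds (by simpa using hz))
    filter_upwards [hnear] with w hw
    rw [norm_pow, norm_norm]
    exact key w hw

/-- A solution of a total differential equation with smooth coefficients is smooth. -/
theorem contDiffOn_of_hasFDerivAt_eq {V : E → W →L[ℝ] E} {O : Set E}
    (hV : ContDiffOn ℝ ∞ V O) {σ : W → E} {s : Set W} (hs : IsOpen s) (hσO : MapsTo σ s O)
    (hσ : ∀ w ∈ s, HasFDerivAt σ (V (σ w)) w) : ContDiffOn ℝ ∞ σ s := by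
  rw [contDiffOn_infty]
  intro n
  induction n with
  | zero =>
    rw [Nat.cast_zero, contDiffOn_zero]
    exact fun w hw => (hσ w hw).continuousAt.continuousWithinAt
  | succ n ih =>
    rw [Nat.cast_succ, contDiffOn_succ_iff_fderiv_of_isOpen hs]
    refine ⟨fun w hw => (hσ w hw).differentiableAt.differentiableWithinAt, by simp, ?_⟩
    -- The derivative V ∘ σ is as regular as `σ`, so `σ` gains one order.
    exact ((hV.of_le (by exact_mod_cast le_top)).comp ih hσO).congr fun w hw => (hσ w hw).fderiv

end Frobenius

end PoissonR4

namespace PoissonR4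

open Set Metric
open scoped Topology

/-! ### The horizontal lift of a coordinate plane -/

section PlaneField

variable {Ψ Φ : R4 → R3} {α β : R4 →L[ℝ] ℝ}

/-- The pair of linear functions `(α, β)`, as a map to the Euclidean plane. -/
noncomputable def coordMap (α β : R4 →L[ℝ] ℝ) : R4 →L[ℝ] EuclideanSpace ℝ (Fin 2) :=
  ((EuclideanSpace.equiv (Fin 2) ℝ).symm : (Fin 2 → ℝ) →L[ℝ] EuclideanSpace ℝ (Fin 2)).comp
    (ContinuousLinearMap.pi ![α, β])

theorem coordMap_zero (v : R4) : coordMap α β v 0 = α v := rfl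

theorem coordMap_one (v : R4) : coordMap α β v 1 = β v := rfl

/-- The covector mapped by `Λ^#` to the horizontal lift of `w`. -/
noncomputable def planeCovector (Ψ Φ : R4 → R3) (α β : R4 →L[ℝ] ℝ) (x : R4)
    (w : EuclideanSpace ℝ (Fin 2)) : R4 →L[ℝ] ℝ :=
  (β (sharp Ψ Φ x α))⁻¹ • (w 1 • α - w 0 • β)

/-- The horizontal lift at `x` from the `(α, β)`-plane to the span of `Λ^#(α)` and `Λ^#(β)`. -/
noncomputable def planeField (Ψ Φ : R4 → R3) (α β : R4 →L[ℝ] ℝ) (x : R4) :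
    EuclideanSpace ℝ (Fin 2) →L[ℝ] R4 :=
  (β (sharp Ψ Φ x α))⁻¹ •
    ((EuclideanSpace.proj (1 : Fin 2)).smulRight (sharp Ψ Φ x α)
      - (EuclideanSpace.proj (0 : Fin 2)).smulRight (sharp Ψ Φ x β))

theorem planeField_apply (x : R4) (w : EuclideanSpace ℝ (Fin 2)) :
    planeField Ψ Φ α β x w
      = (β (sharp Ψ Φ x α))⁻¹ • (w 1 • sharp Ψ Φ x α - w 0 • sharp Ψ Φ x β) := rfl

theorem planeField_eq_sharp (x : R4) (w : EuclideanSpace ℝ (Fin 2)) :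
    planeField Ψ Φ α β x w = sharp Ψ Φ x (planeCovector Ψ Φ α β x w) := by
  rw [planeField_apply, planeCovector, map_smul, map_sub, map_smul, map_smul]

theorem coordMap_planeField {x : R4} (hk : β (sharp Ψ Φ x α) ≠ 0)
    (w : EuclideanSpace ℝ (Fin 2)) : coordMap α β (planeField Ψ Φ α β x w) = w := by
  ext i
  fin_cases i
  · change α (planeField Ψ Φ α β x w) = w 0
    rw [planeField_apply, map_smul, map_sub, map_smul, map_smul, apply_sharp_self,
      apply_sharp_antisymm β α]
    simp only [smul_eq_mul]
    field_simp
    ring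
  · change β (planeField Ψ Φ α β x w) = w 1
    rw [planeField_apply, map_smul, map_sub, map_smul, map_smul, apply_sharp_self]
    simp only [smul_eq_mul]
    field_simp
    ring

theorem sharp_eq_planeField {x : R4} (hF : Φ x ⬝ᵥ Ψ x = 0) (hk : β (sharp Ψ Φ x α) ≠ 0)
    (η : R4 →L[ℝ] ℝ) :
    sharp Ψ Φ x η = planeField Ψ Φ α β x (coordMap α β (sharp Ψ Φ x η)) := by
  rw [planeField_apply, coordMap_zero, coordMap_one]
  exact sharp_mem_span_pair hF hk η

theorem range_planeField {x : R4} (hF : Φ x ⬝ᵥ Ψ x = 0) (hk : β (sharp Ψ Φ x α) ≠ 0) :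
    LinearMap.range (planeField Ψ Φ α β x : EuclideanSpace ℝ (Fin 2) →ₗ[ℝ] R4)
      = LinearMap.range (sharp Ψ Φ x) := by
  ext v
  constructor
  · rintro ⟨w, rfl⟩
    exact ⟨_, (planeField_eq_sharp x w).symm⟩
  · rintro ⟨η, rfl⟩
    exact ⟨_, (sharp_eq_planeField hF hk η).symm⟩

theorem planeField_injective {x : R4} (hk : β (sharp Ψ Φ x α) ≠ 0) :
    Function.Injective (planeField Ψ Φ α β x) :=
  Function.LeftInverse.injective (coordMap_planeField hk)

namespace IsPoissonTensor

variable (hΛ : IsPoissonTensor Ψ Φ)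

include hΛ

theorem contDiffAt_planeField {x : R4} (hk : β (sharp Ψ Φ x α) ≠ 0) :
    ContDiffAt ℝ ∞ (planeField Ψ Φ α β) x := by
  have h : ∀ η : R4 →L[ℝ] ℝ, ContDiffAt ℝ ∞ (fun y => sharp Ψ Φ y η) x := fun η =>
    (hΛ.contDiff_sharp η).contDiffAt
  refine ((hΛ.contDiff_apply_sharp α β).contDiffAt.inv hk).smul ?_
  exact (contDiffAt_const.smulRight (h α)).sub (contDiffAt_const.smulRight (h β))

theorem isOpen_apply_sharp_ne_zero (α β : R4 →L[ℝ] ℝ) :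
    IsOpen {x | β (sharp Ψ Φ x α) ≠ 0} :=
  isOpen_ne.preimage (hΛ.contDiff_apply_sharp α β).continuous

/-- The horizontal lift of the `(α, β)`-plane is integrable where `Λ` has rank two. -/
theorem fderiv_planeField_symm {x : R4} (hF : Φ x ⬝ᵥ Ψ x = 0) (hk : β (sharp Ψ Φ x α) ≠ 0)
    (v w : EuclideanSpace ℝ (Fin 2)) :
    fderiv ℝ (planeField Ψ Φ α β) x (planeField Ψ Φ α β x v) w
      = fderiv ℝ (planeField Ψ Φ α β) x (planeField Ψ Φ α β x w) v := by
  have hd : ∀ η : R4 →L[ℝ] ℝ, HasFDerivAt (fun y => sharp Ψ Φ y η)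
      (fderiv ℝ (fun y => sharp Ψ Φ y η) x) x := fun η =>
    ((hΛ.contDiff_sharp η).differentiable (by simp) x).hasFDerivAt
  have hkd := ((hΛ.contDiff_apply_sharp α β).differentiable (by simp) x).hasFDerivAt
  have hκ := (hasDerivAt_inv hk).comp_hasFDerivAt x hkd
  have hV := ((hΛ.contDiffAt_planeField hk).differentiableAt (by simp)).hasFDerivAt
  have hVw : ∀ u w : EuclideanSpace ℝ (Fin 2), fderiv ℝ (planeField Ψ Φ α β) x
      (planeField Ψ Φ α β x u) w = _ := fun u w => by
    have h1 := (hV.clm_apply (hasFDerivAt_const w x)).fderiv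
    have h2 := (hκ.fun_smul (((hd α).const_smul (w 1)).sub ((hd β).const_smul (w 0)))).fderiv
    have h3 := DFunLike.congr_fun (h1.symm.trans h2) (planeField Ψ Φ α β x u)
    simp only [ContinuousLinearMap.comp_zero, zero_add, ContinuousLinearMap.flip_apply] at h3
    exact h3
  rw [hVw v w, hVw w v]
  have hL := hΛ.lieBracket_sharp α β x
  have hX := sharp_mem_span_pair hF hk (fderiv ℝ (fun y => β (sharp Ψ Φ y α)) x)
  simp only [planeField_apply, map_smul, map_sub]
  simp only [add_apply, sub_apply, FunLike.coe_smul, Pi.smul_apply,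
    ContinuousLinearMap.smulRight_apply, Pi.sub_apply, smul_eq_mul,
    Function.comp_apply]
  generalize fderiv ℝ (fun y => β (sharp Ψ Φ y α)) x = dk at *
  rw [apply_sharp_antisymm dk β, apply_sharp_antisymm dk α] at hX
  generalize fderiv ℝ (fun y => sharp Ψ Φ y α) x = A at *
  generalize fderiv ℝ (fun y => sharp Ψ Φ y β) x = B at *
  generalize β (sharp Ψ Φ x α) = k at *
  rw [hX] at hL
  clear hX hV hVw hκ hkd hd hF hk
  generalize sharp Ψ Φ x α = Xa at *
  generalize sharp Ψ Φ x β = Xb at *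
  generalize A Xa = aa, A Xb = ab, B Xa = ba, B Xb = bb at *
  generalize dk Xa = da, dk Xb = db at *
  generalize v 0 = v0, v 1 = v1, w 0 = w0, w 1 = w1 at *
  rw [← sub_eq_zero] at hL ⊢
  -- The difference of the two sides is alternating in `v` and `w`, hence a multiple of v₀w₁ - w₀v₁;
  -- the vector factor is k⁻² times the commutator relation, with its right side expanded by `hX`.
  have e := congrArg (fun u => ((k⁻¹) ^ 2 * (v0 * w1 - w0 * v1)) • u) hL
  simp only [smul_zero] at e
  refine Eq.trans ?_ e
  match_scalars <;> ring_nf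

end IsPoissonTensor

end PlaneField

end PoissonR4

namespace PoissonR4

open Set Metric
open scoped Topology

/-! ### Plaques: local pieces of two-dimensional leaves -/

section Plaques

variable {Ψ Φ : R4 → R3} {α β : R4 →L[ℝ] ℝ} {c : EuclideanSpace ℝ (Fin 2)} {δ : ℝ}
  {σ : EuclideanSpace ℝ (Fin 2) → R4}

/-- `σ` parametrizes a piece of a two-dimensional leaf by the functions `α` and `β`. -/
structure IsPlaque (Ψ Φ : R4 → R3) (α β : R4 →L[ℝ] ℝ) (c : EuclideanSpace ℝ (Fin 2)) (δ : ℝ)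
    (σ : EuclideanSpace ℝ (Fin 2) → R4) : Prop where
  pos : 0 < δ
  bracket_ne_zero : ∀ z ∈ ball c δ, β (sharp Ψ Φ (σ z) α) ≠ 0
  pfaffian_eq_zero : ∀ z ∈ ball c δ, Φ (σ z) ⬝ᵥ Ψ (σ z) = 0
  hasFDerivAt : ∀ z ∈ ball c δ, HasFDerivAt σ (planeField Ψ Φ α β (σ z)) z
  coordMap_apply : ∀ z ∈ ball c δ, coordMap α β (σ z) = z

theorem isTangentCurve_of_planeField (hΛ : IsPoissonTensor Ψ Φ) {γ : ℝ → R4} {a b : ℝ}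
    {w : EuclideanSpace ℝ (Fin 2)} (hk : ∀ t ∈ Icc a b, β (sharp Ψ Φ (γ t) α) ≠ 0)
    (hγ : ∀ t ∈ Icc a b, HasDerivWithinAt γ (planeField Ψ Φ α β (γ t) w) (Icc a b) t) :
    IsTangentCurve Ψ Φ γ (fun t => planeCovector Ψ Φ α β (γ t) w) a b := by
  have hc : ContinuousOn γ (Icc a b) := fun t ht => (hγ t ht).continuousWithinAt
  refine ⟨?_, fun t ht => planeField_eq_sharp (γ t) w ▸ hγ t ht⟩
  exact (((hΛ.contDiff_apply_sharp α β).continuous.comp_continuousOn hc).inv₀ hk).smul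
    continuousOn_const

/-- Through each point where `Λ` has rank two passes a plaque. -/
theorem exists_isPlaque (hΛ : IsPoissonTensor Ψ Φ) {p : R4} (hF : Φ p ⬝ᵥ Ψ p = 0)
    (hk : β (sharp Ψ Φ p α) ≠ 0) :
    ∃ δ σ, IsPlaque Ψ Φ α β (coordMap α β p) δ σ ∧ σ (coordMap α β p) = p := by
  obtain ⟨δ, hδ, σ, h0, hσ⟩ := exists_hasFDerivAt_eq_of_symmetric
    (V := planeField Ψ Φ α β) (hΛ.isOpen_apply_sharp_ne_zero α β)
    (fun x hx => (hΛ.contDiffAt_planeField hx).contDiffWithinAt)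
    (Z := {x | Φ x ⬝ᵥ Ψ x = 0}) (p := p) hk
    (fun γ w h0 hO hγ t ht => (isTangentCurve_of_planeField hΛ hO hγ).pfaffian_eq_zero_of_left hΛ
      (by rw [h0]; exact hF) ht)
    (fun x hx hxZ v w => hΛ.fderiv_planeField_symm hxZ hx v w)
  have hm : ∀ z ∈ ball (coordMap α β p) δ, z - coordMap α β p ∈
      ball (0 : EuclideanSpace ℝ (Fin 2)) δ := fun z hz => by
    rwa [mem_ball_zero_iff, ← dist_eq_norm]
  have hd : ∀ z ∈ ball (coordMap α β p) δ,
      HasFDerivAt (fun z => σ (z - coordMap α β p))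
        (planeField Ψ Φ α β (σ (z - coordMap α β p))) z := fun z hz => by
    have h1 := (hσ _ (hm z hz)).2.2.comp z ((hasFDerivAt_id z).sub_const (coordMap α β p))
    exact h1
  refine ⟨δ, fun z => σ (z - coordMap α β p), ⟨hδ, fun z hz => (hσ _ (hm z hz)).1,
    fun z hz => (hσ _ (hm z hz)).2.1, hd, fun z hz => ?_⟩, by simp [h0]⟩
  -- The coordinate map inverts the lift, so the coordinates of σ have identity derivative; they
  -- agree with `z` at the centre and hence everywhere.
  have hd0 : ∀ z ∈ ball (coordMap α β p) δ,
      HasFDerivAt (fun z => coordMap α β (σ (z - coordMap α β p)) - z)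
        (0 : EuclideanSpace ℝ (Fin 2) →L[ℝ] EuclideanSpace ℝ (Fin 2)) z := fun z hz => by
    have h1 := ((coordMap α β).hasFDerivAt.comp z (hd z hz)).sub (hasFDerivAt_id z)
    have e : (coordMap α β).comp (planeField Ψ Φ α β (σ (z - coordMap α β p)))
        - ContinuousLinearMap.id ℝ (EuclideanSpace ℝ (Fin 2)) = 0 :=
      ContinuousLinearMap.ext fun w => sub_eq_zero.2 (coordMap_planeField (hσ _ (hm z hz)).1 w)
    exact e ▸ h1
  have h1 := isOpen_ball.is_const_of_fderiv_eq_zero (convex_ball _ δ).isPreconnected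
    (fun z hz => (hd0 z hz).differentiableAt.differentiableWithinAt)
    (fun z hz => (hd0 z hz).fderiv) hz (mem_ball_self hδ)
  simp only [sub_self, h0] at h1
  exact sub_eq_zero.1 h1

namespace IsPlaque

theorem contDiffOn (hΛ : IsPoissonTensor Ψ Φ) (h : IsPlaque Ψ Φ α β c δ σ) :
    ContDiffOn ℝ ∞ σ (ball c δ) :=
  contDiffOn_of_hasFDerivAt_eq
    (fun _ hx => (hΛ.contDiffAt_planeField (α := α) (β := β) hx).contDiffWithinAt)
    isOpen_ball h.bracket_ne_zero h.hasFDerivAt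

theorem center_mem (h : IsPlaque Ψ Φ α β c δ σ) : c ∈ ball c δ := mem_ball_self h.pos

theorem hasDerivAt_segment (h : IsPlaque Ψ Φ α β c δ σ) {z w : EuclideanSpace ℝ (Fin 2)} {t : ℝ}
    (ht : z + t • w ∈ ball c δ) :
    HasDerivAt (fun t : ℝ => σ (z + t • w)) (planeField Ψ Φ α β (σ (z + t • w)) w) t := by
  have h1 : HasDerivAt (fun t : ℝ => z + t • w) w t := by
    have h2 := ((hasDerivAt_id t).smul_const w).const_add z
    rw [one_smul] at h2
    exact h2
  exact (h.hasFDerivAt _ ht).comp_hasDerivAt t h1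

/-- A plaque is contained in the leaf of its centre. -/
theorem mem_leaf (hΛ : IsPoissonTensor Ψ Φ) (h : IsPlaque Ψ Φ α β c δ σ)
    {z : EuclideanSpace ℝ (Fin 2)} (hz : z ∈ ball c δ) : σ z ∈ leaf Ψ Φ (σ c) := by
  by_cases hzc : z = c
  · exact hzc ▸ mem_leaf_self _
  have hv : z - c ≠ 0 := sub_ne_zero.2 hzc
  have hv' : 0 < ‖z - c‖ := norm_pos_iff.2 hv
  have hvr : ‖z - c‖ < δ := by rwa [← dist_eq_norm]
  obtain ⟨f, hf⟩ := SeparatingDual.exists_eq_one (R := ℝ) hv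
  have hε : 0 < δ / ‖z - c‖ - 1 := by
    rw [sub_pos, one_lt_div hv']
    exact hvr
  have hmem : ∀ t ∈ Ioo (-(δ / ‖z - c‖ - 1)) (1 + (δ / ‖z - c‖ - 1)),
      c + t • (z - c) ∈ ball c δ := by
    intro t ht
    have h1 : |t| < δ / ‖z - c‖ := abs_lt.2 ⟨by linarith [ht.1], by linarith [ht.2]⟩
    rw [lt_div_iff₀ hv'] at h1
    simpa [norm_smul] using h1
  have hmem' : ∀ t ∈ Icc (0 : ℝ) 1, c + t • (z - c) ∈ ball c δ := fun t ht =>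
    hmem t ⟨by linarith [ht.1], by linarith [ht.2]⟩
  have hγ : ContDiffOn ℝ ∞ (fun t : ℝ => σ (c + t • (z - c)))
      (Ioo (-(δ / ‖z - c‖ - 1)) (1 + (δ / ‖z - c‖ - 1))) :=
    (h.contDiffOn hΛ).comp (contDiff_const.add (contDiff_id.smul contDiff_const)).contDiffOn hmem
  have harc := hamiltonianArc_of_transversal (Ψ := Ψ) (Φ := Φ)
    (γ := fun t : ℝ => σ (c + t • (z - c)))
    (α := fun t => planeCovector Ψ Φ α β (σ (c + t • (z - c))) (z - c))
    (ρ := fun x => f (coordMap α β x - c)) hε hγ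
    ((((hΛ.contDiff_apply_sharp α β).comp_contDiffOn hγ).inv
      fun t ht => h.bracket_ne_zero _ (hmem t ht)).smul contDiffOn_const)
    (f.contDiff.comp ((coordMap α β).contDiff.sub contDiff_const))
    (fun t ht => by simp [h.coordMap_apply _ (hmem' t ht), hf, -map_sub])
    (fun t ht => planeField_eq_sharp (σ (c + t • (z - c))) (z - c) ▸
      h.hasDerivAt_segment (hmem' t ht))
  have h0 : c + (0 : ℝ) • (z - c) = c := by simp
  have h1 : c + (1 : ℝ) • (z - c) = z := by simp
  simp only [h0, h1] at harc
  exact harc.mem_leaf (mem_leaf_self _)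

/-- A curve tangent to the characteristic distribution which starts in a plaque stays in it. -/
theorem eq_of_isTangentCurve (hΛ : IsPoissonTensor Ψ Φ) (h : IsPlaque Ψ Φ α β c δ σ)
    {γ : ℝ → R4} {η : ℝ → R4 →L[ℝ] ℝ} {a b : ℝ} (hγ : IsTangentCurve Ψ Φ γ η a b)
    (hF : ∀ t ∈ Icc a b, Φ (γ t) ⬝ᵥ Ψ (γ t) = 0)
    (hk : ∀ t ∈ Icc a b, β (sharp Ψ Φ (γ t) α) ≠ 0)
    (hball : ∀ t ∈ Icc a b, coordMap α β (γ t) ∈ ball c δ)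
    (h0 : σ (coordMap α β (γ a)) = γ a) {t : ℝ} (ht : t ∈ Icc a b) :
    σ (coordMap α β (γ t)) = γ t := by
  -- `τ` lifts the coordinate projection of `γ` back to the plaque. Both curves solve x' = V(x)
  -- u(t), with V the horizontal lift and `u` the same coordinate velocity, so uniqueness identifies
  -- them.
  set τ : ℝ → R4 := fun t => σ (coordMap α β (γ t)) with hτ
  set u : ℝ → EuclideanSpace ℝ (Fin 2) :=
    fun t => coordMap α β (sharp Ψ Φ (γ t) (η t)) with hu
  have hγc := hγ.continuousOn
  have hπc : ContinuousOn (fun t => coordMap α β (γ t)) (Icc a b) :=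
    (coordMap α β).continuous.comp_continuousOn hγc
  have hτc : ContinuousOn τ (Icc a b) :=
    (h.contDiffOn hΛ).continuousOn.comp hπc hball
  have huc : ContinuousOn u (Icc a b) :=
    (coordMap α β).continuous.comp_continuousOn
      ((hΛ.contDiff_sharpL.continuous.comp_continuousOn hγc).clm_apply hγ.continuousOn_covector)
  obtain ⟨C, hC⟩ := isCompact_Icc.exists_bound_of_continuousOn huc
  have hS : IsCompact (γ '' Icc a b ∪ τ '' Icc a b) :=
    (isCompact_Icc.image_of_continuousOn hγc).union (isCompact_Icc.image_of_continuousOn hτc)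
  obtain ⟨K, hK⟩ := LocallyLipschitzOn.exists_lipschitzOnWith_of_compact
    (f := planeField Ψ Φ α β) hS (fun x hx => by
      have hx' : β (sharp Ψ Φ x α) ≠ 0 := by
        rcases hx with ⟨s, hs, rfl⟩ | ⟨s, hs, rfl⟩
        · exact hk s hs
        · exact h.bracket_ne_zero _ (hball s hs)
      obtain ⟨K, T, hT, hKT⟩ := ((hΛ.contDiffAt_planeField hx').of_le
        (by simp : (1 : WithTop ℕ∞) ≤ ∞)).exists_lipschitzOnWith
      exact ⟨K, T, mem_nhdsWithin_of_mem_nhds hT, hKT⟩)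
  refine sub_eq_zero.1 (eq_zero_of_abs_deriv_le_mul_abs_self_of_eq_zero_right
    (f := fun t => τ t - γ t) (K := K * C)
    (f' := fun t => planeField Ψ Φ α β (τ t) (u t) - sharp Ψ Φ (γ t) (η t)) (hτc.sub hγc)
    (fun s hs => ?_) (sub_eq_zero.2 h0) (fun s hs => ?_) t ht)
  · have hs' := Ico_subset_Icc_self hs
    have h1 := (coordMap α β).hasFDerivAt.comp_hasDerivWithinAt s (hγ.hasDerivWithinAt_Ici hs)
    exact ((h.hasFDerivAt _ (hball s hs')).comp_hasDerivWithinAt s h1).sub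
      (hγ.hasDerivWithinAt_Ici hs)
  · have hs' := Ico_subset_Icc_self hs
    rw [sharp_eq_planeField (hF s hs') (hk s hs') (η s), ← sub_apply]
    have h2 := hK.norm_sub_le (Or.inr (mem_image_of_mem τ hs')) (Or.inl (mem_image_of_mem γ hs'))
    calc _ ≤ ‖planeField Ψ Φ α β (τ s) - planeField Ψ Φ α β (γ s)‖ * ‖u s‖ :=
          ContinuousLinearMap.le_opNorm _ _
      _ ≤ (K * ‖τ s - γ s‖) * C := by
        gcongr
        exact hC s hs'
      _ = _ := by ring

/-- The intersection of two plaques is open in each of them. -/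
theorem eventually_mem (hΛ : IsPoissonTensor Ψ Φ) (h : IsPlaque Ψ Φ α β c δ σ)
    {α' β' : R4 →L[ℝ] ℝ} {c' : EuclideanSpace ℝ (Fin 2)} {δ' : ℝ}
    {σ' : EuclideanSpace ℝ (Fin 2) → R4} (h' : IsPlaque Ψ Φ α' β' c' δ' σ')
    {z z' : EuclideanSpace ℝ (Fin 2)} (hz : z ∈ ball c δ) (hz' : z' ∈ ball c' δ')
    (hzz' : σ z = σ' z') :
    ∀ᶠ w in 𝓝 z, coordMap α' β' (σ w) ∈ ball c' δ' ∧ σ' (coordMap α' β' (σ w)) = σ w := by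
  have hcz : ContinuousAt σ z := (h.hasFDerivAt z hz).continuousAt
  have hπz : coordMap α' β' (σ z) = z' := by rw [hzz', h'.coordMap_apply z' hz']
  have e1 : ∀ᶠ w in 𝓝 z, coordMap α' β' (σ w) ∈ ball c' δ' :=
    ((coordMap α' β').continuous.continuousAt.comp hcz).eventually_mem
      (isOpen_ball.mem_nhds (by rw [Function.comp_apply, hπz]; exact hz'))
  have e2 : ∀ᶠ w in 𝓝 z, β' (sharp Ψ Φ (σ w) α') ≠ 0 :=
    hcz.eventually_mem ((hΛ.isOpen_apply_sharp_ne_zero α' β').mem_nhds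
      (by rw [hzz']; exact h'.bracket_ne_zero z' hz'))
  have e3 : ∀ᶠ w in 𝓝 z, w ∈ ball c δ := isOpen_ball.mem_nhds hz
  obtain ⟨r, hr, hsub⟩ := Metric.eventually_nhds_iff_ball.1 (e1.and (e2.and e3))
  filter_upwards [ball_mem_nhds z hr] with w hw
  have hseg : ∀ t ∈ Icc (0 : ℝ) 1, z + t • (w - z) ∈ ball z r := fun t ht => by
    have h1 := (convex_ball z r).add_smul_sub_mem (mem_ball_self hr) hw ht
    exact h1
  -- The image under `σ` of the segment from `z` to `w` is a tangent curve that starts in the second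
  -- plaque, so it remains there.
  have hcurve := isTangentCurve_of_planeField (α := α) (β := β) hΛ (a := 0) (b := 1) (w := w - z)
    (γ := fun t : ℝ => σ (z + t • (w - z)))
    (fun t ht => h.bracket_ne_zero _ (hsub _ (hseg t ht)).2.2)
    (fun t ht => (h.hasDerivAt_segment (hsub _ (hseg t ht)).2.2).hasDerivWithinAt)
  have h1 := h'.eq_of_isTangentCurve hΛ hcurve
    (fun t ht => h.pfaffian_eq_zero _ (hsub _ (hseg t ht)).2.2)
    (fun t ht => (hsub _ (hseg t ht)).2.1) (fun t ht => (hsub _ (hseg t ht)).1)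
    (by simp only [zero_smul, add_zero, hπz, hzz'.symm]) (t := 1) (by simp)
  refine ⟨(hsub w hw).1, ?_⟩
  simpa using h1

/-- A curve tangent to the characteristic distribution which meets a plaque remains in it for times
close to the meeting time. -/
theorem eventually_eq_of_isTangentCurve (hΛ : IsPoissonTensor Ψ Φ) (h : IsPlaque Ψ Φ α β c δ σ)
    {γ : ℝ → R4} {η : ℝ → R4 →L[ℝ] ℝ} {a b : ℝ} (hγ : IsTangentCurve Ψ Φ γ η a b) {s : ℝ}
    (hs : s ∈ Icc a b) {z : EuclideanSpace ℝ (Fin 2)} (hz : z ∈ ball c δ) (hσz : σ z = γ s) :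
    ∀ᶠ t in 𝓝[Icc a b] s, coordMap α β (γ t) ∈ ball c δ ∧ σ (coordMap α β (γ t)) = γ t := by
  have hFs : Φ (γ s) ⬝ᵥ Ψ (γ s) = 0 := hσz ▸ h.pfaffian_eq_zero z hz
  have hF : ∀ t ∈ Icc a b, Φ (γ t) ⬝ᵥ Ψ (γ t) = 0 := fun t ht =>
    hγ.pfaffian_eq_zero hΛ hs ht hFs
  have hπs : coordMap α β (γ s) = z := by rw [← hσz, h.coordMap_apply z hz]
  have hcs : ContinuousWithinAt γ (Icc a b) s := hγ.continuousOn s hs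
  have e1 : ∀ᶠ t in 𝓝[Icc a b] s, coordMap α β (γ t) ∈ ball c δ :=
    ((coordMap α β).continuous.continuousAt.comp_continuousWithinAt hcs).eventually_mem
      (isOpen_ball.mem_nhds (by rw [Function.comp_apply, hπs]; exact hz))
  have e2 : ∀ᶠ t in 𝓝[Icc a b] s, β (sharp Ψ Φ (γ t) α) ≠ 0 :=
    hcs.eventually_mem ((hΛ.isOpen_apply_sharp_ne_zero α β).mem_nhds
      (by rw [← hσz]; exact h.bracket_ne_zero z hz))
  obtain ⟨r, hr, hsub⟩ := Metric.mem_nhdsWithin_iff.1 (e1.and e2)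
  have hr' : ball s r ∩ Icc a b ∈ 𝓝[Icc a b] s := Filter.inter_mem
    (mem_nhdsWithin_of_mem_nhds (ball_mem_nhds s hr)) self_mem_nhdsWithin
  filter_upwards [hr'] with t ht
  refine ⟨(hsub ht).1, ?_⟩
  have hconv : Convex ℝ (ball s r ∩ Icc a b) := (convex_ball s r).inter (convex_Icc a b)
  have hord := hconv.ordConnected
  have hsm : s ∈ ball s r ∩ Icc a b := ⟨mem_ball_self hr, hs⟩
  rcases le_total s t with hst | hst
  · have hI := hord.out hsm ht
    exact h.eq_of_isTangentCurve hΛ (hγ.mono fun x hx => (hI hx).2) (fun x hx => hF x (hI hx).2)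
      (fun x hx => (hsub (hI hx)).2) (fun x hx => (hsub (hI hx)).1)
      (by rw [hπs, hσz]) (right_mem_Icc.2 hst)
  -- Times before `s` are reached by running the curve backwards from `s`.
  · have hI := hord.out ht hsm
    have hm : ∀ x ∈ Icc t s, t + s - x ∈ Icc t s := fun x hx =>
      ⟨by linarith [hx.2], by linarith [hx.1]⟩
    have h1 := h.eq_of_isTangentCurve hΛ (hγ.mono fun x hx => (hI hx).2).reverse
      (fun x hx => hF _ (hI (hm x hx)).2)
      (fun x hx => (hsub (hI (hm x hx))).2) (fun x hx => (hsub (hI (hm x hx))).1)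
      (by simp [hπs, hσz]) (right_mem_Icc.2 hst)
    simpa using h1

end IsPlaque

end Plaques

end PoissonR4

namespace PoissonR4

open Set

/-! ### From charts and a dual form to a symplectic leaf -/

section SymplecticLeaves

variable {Ψ Φ : R4 → R3} {k : ℕ} {M : Type} [TopologicalSpace M]
  [ChartedSpace (EuclideanSpace ℝ (Fin k)) M]

theorem contMDiff_of_charts [IsManifold (𝓡 k) ∞ M] {ι : M → R4}
    (hsm : ∀ e ∈ atlas (EuclideanSpace ℝ (Fin k)) M, ContDiffOn ℝ ∞ (ι ∘ e.symm) e.target) :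
    ContMDiff (𝓡 k) 𝓘(ℝ, R4) ∞ ι := by
  intro m
  let e := chartAt (EuclideanSpace ℝ (Fin k)) m
  have hm : m ∈ e.source := mem_chart_source _ m
  have h1 : ContMDiffAt (𝓡 k) 𝓘(ℝ, R4) ∞ (ι ∘ e.symm) (e m) :=
    ((hsm e (chart_mem_atlas _ m)).contDiffAt
      (e.open_target.mem_nhds (e.map_source hm))).contMDiffAt
  have h2 : ContMDiffAt (𝓡 k) (𝓡 k) ∞ e m :=
    contMDiffOn_chart.contMDiffAt (e.open_source.mem_nhds hm)
  refine (h1.comp m h2).congr_of_eventuallyEq ?_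
  filter_upwards [e.open_source.mem_nhds hm] with x hx
  simp [e.left_inv hx]

theorem mfderiv_eq_fderiv_chartAt {ι : M → R4} {m : M}
    (h : MDifferentiableAt (𝓡 k) 𝓘(ℝ, R4) ι m) :
    mfderiv (𝓡 k) 𝓘(ℝ, R4) ι m
      = fderiv ℝ (ι ∘ (chartAt (EuclideanSpace ℝ (Fin k)) m).symm)
        (chartAt (EuclideanSpace ℝ (Fin k)) m m) := by
  have h1 : fderivWithin ℝ (writtenInExtChartAt (𝓡 k) 𝓘(ℝ, R4) m ι) (range (𝓡 k))
        (extChartAt (𝓡 k) m m)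
      = fderiv ℝ (ι ∘ (chartAt (EuclideanSpace ℝ (Fin k)) m).symm)
        (chartAt (EuclideanSpace ℝ (Fin k)) m m) := by
    simp only [writtenInExtChartAt, mfld_simps, fderivWithin_univ]
    rfl
  exact (if_pos h).trans h1

theorem mfderiv_comp_mfderiv_symm [IsManifold (𝓡 k) ∞ M] {ι : M → R4}
    (h : ContMDiff (𝓡 k) 𝓘(ℝ, R4) ∞ ι)
    {e : OpenPartialHomeomorph M (EuclideanSpace ℝ (Fin k))}
    (he : e ∈ atlas (EuclideanSpace ℝ (Fin k)) M) {x : EuclideanSpace ℝ (Fin k)}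
    (hx : x ∈ e.target) :
    (mfderiv (𝓡 k) 𝓘(ℝ, R4) ι (e.symm x)).comp (mfderiv (𝓡 k) (𝓡 k) e.symm x)
      = fderiv ℝ (ι ∘ e.symm) x := by
  have : IsManifold (𝓡 k) 1 M := IsManifold.of_le (n := ∞) (by simp)
  rw [← mfderiv_eq_fderiv]
  exact (mfderiv_comp x (h.mdifferentiable (by simp) _) (mdifferentiableAt_atlas_symm he hx)).symm

theorem compContinuousLinearMap_pair {E F : Type*} [AddCommGroup E] [Module ℝ E]
    [TopologicalSpace E] [AddCommGroup F] [Module ℝ F] [TopologicalSpace F]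
    (η : F [⋀^Fin 2]→L[ℝ] ℝ) (T : E →L[ℝ] F) (u v : E) :
    η.compContinuousLinearMap T ![u, v] = η ![T u, T v] := by
  rw [ContinuousAlternatingMap.compContinuousLinearMap_apply]
  congr 1
  ext1 i
  fin_cases i <;> rfl

/-- The pull-back to `M` of a 2-form on `ℝ⁴`. -/
noncomputable def pullbackForm (θ : R4 → R4 [⋀^Fin 2]→L[ℝ] ℝ) (ι : M → R4) (m : M) :
    TangentSpace (𝓡 k) m [⋀^Fin 2]→L[ℝ] ℝ :=
  (θ (ι m)).compContinuousLinearMap (mfderiv (𝓡 k) 𝓘(ℝ, R4) ι m)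

theorem formInChart_pullbackForm [IsManifold (𝓡 k) ∞ M] {ι : M → R4}
    (h : ContMDiff (𝓡 k) 𝓘(ℝ, R4) ∞ ι) (θ : R4 → R4 [⋀^Fin 2]→L[ℝ] ℝ)
    {e : OpenPartialHomeomorph M (EuclideanSpace ℝ (Fin k))}
    (he : e ∈ atlas (EuclideanSpace ℝ (Fin k)) M) {x : EuclideanSpace ℝ (Fin k)}
    (hx : x ∈ e.target) :
    formInChart (pullbackForm θ ι) e x
      = (θ ((ι ∘ e.symm) x)).compContinuousLinearMap (fderiv ℝ (ι ∘ e.symm) x) := by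
  rw [← mfderiv_comp_mfderiv_symm h he hx]
  rfl

theorem contDiffAt_comp_fderiv {E : Type*} [NormedAddCommGroup E] [NormedSpace ℝ E]
    [FiniteDimensional ℝ E] {A B : R4 → R3} {ψ : E → R4} {x : E}
    (hA : ContDiffAt ℝ ∞ A (ψ x)) (hB : ContDiffAt ℝ ∞ B (ψ x)) (hψ : ContDiffAt ℝ ∞ ψ x) :
    ContDiffAt ℝ ∞ (fun y => (twoForm (A (ψ y)) (B (ψ y))).compContinuousLinearMap
      (fderiv ℝ ψ y)) x := by
  refine contDiffWithinAt_of_forall_apply fun v => ?_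
  have hd : ContDiffAt ℝ ∞ (fderiv ℝ ψ) x := hψ.fderiv_right (by simp)
  have hv : ∀ i, ContDiffAt ℝ ∞ (fun y => fderiv ℝ ψ y (v i)) x := fun i =>
    hd.clm_apply contDiffAt_const
  have h1 : ∀ i j, ContDiffAt ℝ ∞ (fun y => (fderiv ℝ ψ y (v i)).1 j) x := fun i j =>
    contDiffAt_pi.1 (contDiff_fst.contDiffAt.comp x (hv i)) j
  have h2 : ∀ i, ContDiffAt ℝ ∞ (fun y => (fderiv ℝ ψ y (v i)).2) x := fun i =>
    contDiff_snd.contDiffAt.comp x (hv i)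
  have hA' := fun i => contDiffAt_pi.1 (hA.comp x hψ) i
  have hB' := fun i => contDiffAt_pi.1 (hB.comp x hψ) i
  change ContDiffAt ℝ ∞ (fun y => A (ψ y) ⬝ᵥ ((fderiv ℝ ψ y (v 0)).1 ⨯₃ (fderiv ℝ ψ y (v 1)).1)
    + B (ψ y) ⬝ᵥ ((fderiv ℝ ψ y (v 1)).2 • (fderiv ℝ ψ y (v 0)).1
      - (fderiv ℝ ψ y (v 0)).2 • (fderiv ℝ ψ y (v 1)).1)) x
  simp only [cross_apply, dotProduct, Fin.sum_univ_three, Pi.sub_apply, Pi.smul_apply, smul_eq_mul,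
    Matrix.cons_val_zero, Matrix.cons_val_one, Matrix.cons_val]
  have hm : ∀ i j l m, ContDiffAt ℝ ∞ (fun y => (fderiv ℝ ψ y (v 0)).1 i * (fderiv ℝ ψ y (v 1)).1 j
      - (fderiv ℝ ψ y (v 0)).1 l * (fderiv ℝ ψ y (v 1)).1 m) x := fun i j l m =>
    ((h1 0 i).mul (h1 1 j)).sub ((h1 0 l).mul (h1 1 m))
  have hn : ∀ i, ContDiffAt ℝ ∞ (fun y => (fderiv ℝ ψ y (v 1)).2 * (fderiv ℝ ψ y (v 0)).1 i
      - (fderiv ℝ ψ y (v 0)).2 * (fderiv ℝ ψ y (v 1)).1 i) x := fun i =>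
    ((h2 1).mul (h1 0 i)).sub ((h2 0).mul (h1 1 i))
  exact ((((hA' 0).mul (hm _ _ _ _)).add ((hA' 1).mul (hm _ _ _ _))).add
    ((hA' 2).mul (hm _ _ _ _))).add ((((hB' 0).mul (hn 0)).add ((hB' 1).mul (hn 1))).add
    ((hB' 2).mul (hn 2)))

/-- A leaf presented as an immersed submanifold by charts is a symplectic leaf, when a
2-form dual to `Λ` along it restricts to a closed form. -/
theorem isSymplecticLeaf_of_charts [IsManifold (𝓡 k) ∞ M] [ConnectedSpace M] {L : Set R4}
    (hL : IsLeaf Ψ Φ L) {ι : M → R4} (hinj : Function.Injective ι) (hrange : range ι = L)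
    (hsm : ∀ e ∈ atlas (EuclideanSpace ℝ (Fin k)) M, ContDiffOn ℝ ∞ (ι ∘ e.symm) e.target)
    (himm : ∀ e ∈ atlas (EuclideanSpace ℝ (Fin k)) M, ∀ x ∈ e.target,
      Function.Injective (fderiv ℝ (ι ∘ e.symm) x))
    (htan : ∀ e ∈ atlas (EuclideanSpace ℝ (Fin k)) M, ∀ x ∈ e.target,
      LinearMap.range (fderiv ℝ (ι ∘ e.symm) x : EuclideanSpace ℝ (Fin k) →ₗ[ℝ] R4)
        = LinearMap.range (sharp Ψ Φ (ι (e.symm x))))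
    {A B : R4 → R3} (hA : ∀ p ∈ L, ContDiffAt ℝ ∞ A p) (hB : ∀ p ∈ L, ContDiffAt ℝ ∞ B p)
    (hdual : ∀ p ∈ L, ∀ α β : R4 →L[ℝ] ℝ,
      twoForm (A p) (B p) ![sharp Ψ Φ p α, sharp Ψ Φ p β] = β (sharp Ψ Φ p α))
    (hclosed : ∀ p ∈ L, ∀ T : EuclideanSpace ℝ (Fin k) →L[ℝ] R4,
      (extDeriv (fun x => twoForm (A x) (B x)) p).compContinuousLinearMap T = 0) :
    IsSymplecticLeaf Ψ Φ k L := by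
  have hι := contMDiff_of_charts hsm
  have hmd : ∀ m, mfderiv (𝓡 k) 𝓘(ℝ, R4) ι m
      = fderiv ℝ (ι ∘ (chartAt (EuclideanSpace ℝ (Fin k)) m).symm)
        (chartAt (EuclideanSpace ℝ (Fin k)) m m) := fun m =>
    mfderiv_eq_fderiv_chartAt (hι.mdifferentiable (by simp) m)
  have hmem : ∀ m, ι m ∈ L := fun m => hrange ▸ mem_range_self m
  have hinjd : ∀ m, Function.Injective (mfderiv (𝓡 k) 𝓘(ℝ, R4) ι m) := fun m => by
    rw [hmd]
    exact himm _ (chart_mem_atlas _ m) _ (mem_chart_target _ m)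
  have htand : ∀ (m : M) (w : R4),
      (∃ u : TangentSpace (𝓡 k) m, mfderiv (𝓡 k) 𝓘(ℝ, R4) ι m u = w) ↔
        w ∈ LinearMap.range (sharp Ψ Φ (ι m)) := fun m w => by
    have h1 := htan _ (chart_mem_atlas _ m) _ (mem_chart_target _ m)
    rw [(chartAt (EuclideanSpace ℝ (Fin k)) m).left_inv (mem_chart_source _ m)] at h1
    rw [← h1, hmd]
    exact Iff.rfl
  have hval : ∀ (m : M) (u v : TangentSpace (𝓡 k) m),
      pullbackForm (fun x => twoForm (A x) (B x)) ι m ![u, v]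
        = twoForm (A (ι m)) (B (ι m)) ![mfderiv (𝓡 k) 𝓘(ℝ, R4) ι m u,
            mfderiv (𝓡 k) 𝓘(ℝ, R4) ι m v] := fun m u v => by
    exact compContinuousLinearMap_pair _ _ u v
  have hψ : ∀ e ∈ atlas (EuclideanSpace ℝ (Fin k)) M, ∀ x ∈ e.target,
      ContDiffAt ℝ ∞ (ι ∘ e.symm) x := fun e he x hx =>
    (hsm e he).contDiffAt (e.open_target.mem_nhds hx)
  have hfc : ∀ e ∈ atlas (EuclideanSpace ℝ (Fin k)) M, ∀ x ∈ e.target,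
      formInChart (pullbackForm (fun x => twoForm (A x) (B x)) ι) e =ᶠ[nhds x]
        fun x => (twoForm (A ((ι ∘ e.symm) x)) (B ((ι ∘ e.symm) x))).compContinuousLinearMap
          (fderiv ℝ (ι ∘ e.symm) x) := fun e he x hx =>
    Filter.eventuallyEq_of_mem (e.open_target.mem_nhds hx)
      fun y hy => formInChart_pullbackForm hι _ he hy
  refine ⟨hL, M, inferInstance, inferInstance, ι, pullbackForm (fun x => twoForm (A x) (B x)) ι,
    inferInstance, inferInstance, ⟨hι, hinj, hinjd, hrange, htand⟩, ⟨?_, ?_, ?_⟩, ?_⟩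
  · intro e he x hx
    exact ((contDiffAt_comp_fderiv (ψ := ι ∘ e.symm) (hA _ (hmem _)) (hB _ (hmem _))
      (hψ e he x hx)).congr_of_eventuallyEq (hfc e he x hx)).contDiffWithinAt
  · intro e he x hx
    rw [(hfc e he x hx).extDeriv_eq]
    have hθ : DifferentiableAt ℝ (fun x => twoForm (A x) (B x)) ((ι ∘ e.symm) x) :=
      (contDiffAt_twoForm (hA _ (hmem _)) (hB _ (hmem _))).differentiableAt (n := ∞) (by simp)
    have h1 := extDeriv_pullback hθ (hψ e he x hx)
      (by rw [minSmoothness_of_isRCLikeNormedField]; exact WithTop.coe_le_coe.2 le_top)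
    exact h1.trans (hclosed _ (hmem _) _)
  -- Every tangent vector is some Λ^#(α), and duality turns degeneracy into β(Λ^#(α)) = 0 for all β.
  · intro m u hu
    obtain ⟨α, hα⟩ := (htand m _).1 ⟨u, rfl⟩
    have h0 : mfderiv (𝓡 k) 𝓘(ℝ, R4) ι m u = 0 := by
      refine hα.symm.trans (vector_ext fun β => ?_)
      obtain ⟨v, hv⟩ := (htand m _).2 ⟨β, rfl⟩
      have h1 := hu v
      rw [hval, hv, ← hα, hdual _ (hmem m)] at h1
      exact h1.trans (map_zero β).symm
    exact hinjd m (h0.trans (map_zero _).symm)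
  · intro f g _ _ m u v hu hv
    rw [hval, hu, hv]
    exact hdual _ (hmem m) _ _

/-- Three vectors in dimension less than 3 are dependent. This gives closedness on leaves of
dimension 0 and 2, where the form on ℝ⁴ itself need not be closed. -/
theorem extDeriv_comp_eq_zero_of_lt {E : Type*} [NormedAddCommGroup E] [NormedSpace ℝ E]
    [FiniteDimensional ℝ E] (hE : Module.finrank ℝ E < 3) (η : R4 [⋀^Fin 3]→L[ℝ] ℝ)
    (T : E →L[ℝ] R4) : η.compContinuousLinearMap T = 0 := by
  ext v
  refine AlternatingMap.map_linearDependent (η.compContinuousLinearMap T).toAlternatingMap v fun h => ?_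
  have := h.fintype_card_le_finrank
  rw [Fintype.card_fin] at this
  omega

end SymplecticLeaves

end PoissonR4

namespace PoissonR4

open Set Metric
open scoped Topology

/-! ### Leaves of dimension zero -/

section RankZero

variable {Ψ Φ : R4 → R3}

/-- A point where `Λ` vanishes is a symplectic leaf of dimension zero. -/
theorem isSymplecticLeaf_leaf_of_norm_sq_eq_zero (hΛ : IsPoissonTensor Ψ Φ) {p : R4}
    (hp : Φ p ⬝ᵥ Φ p + Ψ p ⬝ᵥ Ψ p = 0) : IsSymplecticLeaf Ψ Φ 0 (leaf Ψ Φ p) := by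
  have h0 : sharp Ψ Φ p = 0 := sharp_eq_zero hp
  have hL : leaf Ψ Φ p = {p} := leaf_eq_singleton hΛ h0
  have hfd : ∀ e ∈ atlas (EuclideanSpace ℝ (Fin 0)) (EuclideanSpace ℝ (Fin 0)), ∀ x,
      fderiv ℝ ((fun _ : EuclideanSpace ℝ (Fin 0) => p) ∘ e.symm) x = 0 := fun e _ x =>
    fderiv_const_apply p
  refine isSymplecticLeaf_of_charts (M := EuclideanSpace ℝ (Fin 0)) ⟨p, rfl⟩
    (ι := fun _ => p) (Function.injective_of_subsingleton _) (by rw [range_const, hL])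
    (fun e _ => contDiffOn_const) (fun e _ x _ => Function.injective_of_subsingleton _)
    (fun e he x _ => ?_) (A := fun _ => 0) (B := fun _ => 0) (fun _ _ => contDiffAt_const)
    (fun _ _ => contDiffAt_const) (fun q hq α β => ?_)
    (fun q _ T => extDeriv_comp_eq_zero_of_lt (by simp) _ T)
  · rw [hfd e he x, h0]
    simp
  · rw [hL, mem_singleton_iff] at hq
    subst hq
    simp [h0, twoForm_apply]

end RankZero

/-! ### Leaves of dimension four -/

section RankFour

variable {Ψ Φ : R4 → R3}

/-- The leaf of a point where `Λ` has rank four is a symplectic leaf of dimension four. -/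
theorem isSymplecticLeaf_leaf_of_pfaffian_ne_zero (hΛ : IsPoissonTensor Ψ Φ) {p : R4}
    (hp : Φ p ⬝ᵥ Ψ p ≠ 0) (hconn : IsConnected (leaf Ψ Φ p)) :
    IsSymplecticLeaf Ψ Φ 4 (leaf Ψ Φ p) := by
  have hF : ∀ q ∈ leaf Ψ Φ p, Φ q ⬝ᵥ Ψ q ≠ 0 := fun q hq =>
    right_ne_zero_of_mul (pfaffian_mul_pos_of_mem_leaf hΛ hq hp).ne'
  let φ : R4 ≃L[ℝ] EuclideanSpace ℝ (Fin 4) := ContinuousLinearEquiv.ofFinrankEq (by simp)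
  have : ConnectedSpace (leaf Ψ Φ p) := isConnected_iff_connectedSpace.1 hconn
  -- The leaf is open, so one linear isomorphism restricts to a global chart.
  have hf : Topology.IsOpenEmbedding (fun x : leaf Ψ Φ p => φ x) :=
    φ.toHomeomorph.isOpenEmbedding.comp (isOpen_leaf hΛ hp).isOpenEmbedding_subtypeVal
  let := hf.singletonChartedSpace
  have : IsManifold (𝓡 4) ∞ (leaf Ψ Φ p) := hf.isManifold_singleton
  have heq : ∀ e ∈ atlas (EuclideanSpace ℝ (Fin 4)) (leaf Ψ Φ p),
      EqOn (Subtype.val ∘ e.symm) φ.symm e.target := by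
    intro e he x hx
    obtain rfl : e = hf.toOpenPartialHomeomorph _ := he
    have h1 := (hf.toOpenPartialHomeomorph _).right_inv hx
    rw [φ.symm_apply_eq.2 h1.symm]
    rfl
  have hfd : ∀ e ∈ atlas (EuclideanSpace ℝ (Fin 4)) (leaf Ψ Φ p), ∀ x ∈ e.target,
      fderiv ℝ (Subtype.val ∘ e.symm) x = (φ.symm : EuclideanSpace ℝ (Fin 4) →L[ℝ] R4) := by
    intro e he x hx
    rw [((heq e he).eventuallyEq_of_mem (e.open_target.mem_nhds hx)).fderiv_eq]
    exact φ.symm.fderiv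
  refine isSymplecticLeaf_of_charts (M := leaf Ψ Φ p) ⟨p, rfl⟩ (ι := Subtype.val)
    Subtype.val_injective Subtype.range_coe
    (fun e he => φ.symm.contDiff.contDiffOn.congr (heq e he))
    (fun e he x hx => ?_) (fun e he x hx => ?_)
    (A := fun x => (Φ x ⬝ᵥ Ψ x)⁻¹ • Φ x) (B := fun x => (Φ x ⬝ᵥ Ψ x)⁻¹ • Ψ x)
    (fun q hq => (hΛ.contDiff_pfaffian.contDiffAt.inv (hF q hq)).smul hΛ.smooth_Φ.contDiffAt)
    (fun q hq => (hΛ.contDiff_pfaffian.contDiffAt.inv (hF q hq)).smul hΛ.smooth_Ψ.contDiffAt)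
    (fun q hq => twoForm_sharp_sharp_of_ne_zero (hF q hq)) (fun q hq T => ?_)
  · rw [hfd e he x hx]
    exact φ.symm.injective
  · rw [hfd e he x hx, range_sharp_eq_top (hF _ (e.symm x).2)]
    exact LinearMap.range_eq_top.2 φ.symm.surjective
  · have h1 := hΛ.extDeriv_formFour (hF q hq)
    unfold formFour at h1
    rw [h1]
    rfl

/-- The image of `Λ^#` is the tangent space of an immersed 4-manifold, so the rank is four. -/
theorem pfaffian_ne_zero_of_isSymplecticLeaf {L : Set R4} (h : IsSymplecticLeaf Ψ Φ 4 L) :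
    ∃ p, L = leaf Ψ Φ p ∧ Φ p ⬝ᵥ Ψ p ≠ 0 := by
  obtain ⟨⟨p, hp⟩, M, _, _, ι, _, _, _, hι, _⟩ := h
  have hpL : p ∈ L := hp ▸ mem_leaf_self p
  rw [← hι.range_eq] at hpL
  obtain ⟨m, rfl⟩ := hpL
  refine ⟨ι m, hp, (rank_characterization Ψ Φ (ι m)).2.2.1 ?_⟩
  obtain ⟨T, hT, hTr⟩ : ∃ T : EuclideanSpace ℝ (Fin 4) →L[ℝ] R4, Function.Injective T ∧
      ∀ w, (∃ u, T u = w) ↔ w ∈ LinearMap.range (sharp Ψ Φ (ι m)) :=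
    ⟨mfderiv (𝓡 4) 𝓘(ℝ, R4) ι m, hι.immersion m, hι.tangent m⟩
  have h1 : LinearMap.range (sharp Ψ Φ (ι m)) = LinearMap.range T.toLinearMap :=
    Submodule.ext fun w => (hTr w).symm
  rw [rank, h1, LinearMap.finrank_range_of_inj hT]
  simp

end RankFour

end PoissonR4

namespace PoissonR4

open Set Metric
open scoped Topology

/-! ### Leaves of dimension two: the manifold built from plaques -/

section RankTwo

variable {Ψ Φ : R4 → R3} {α β : R4 →L[ℝ] ℝ} {c : EuclideanSpace ℝ (Fin 2)} {δ : ℝ}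
  {σ : EuclideanSpace ℝ (Fin 2) → R4} {p : R4}

/-- The points of the leaf through `p`; for leaves of dimension two it carries the topology defined
by the plaques, not the topology of a subspace of `ℝ⁴`. -/
@[ext]
structure LeafSpace (Ψ Φ : R4 → R3) (p : R4) where
  /-- The inclusion of a leaf. -/
  val : R4
  val_mem : val ∈ leaf Ψ Φ p

namespace LeafSpace

theorem val_injective : Function.Injective (val : LeafSpace Ψ Φ p → R4) :=
  fun _ _ => LeafSpace.ext

theorem range_val : range (val : LeafSpace Ψ Φ p → R4) = leaf Ψ Φ p :=
  Subset.antisymm (range_subset_iff.2 val_mem) fun q hq => ⟨⟨q, hq⟩, rfl⟩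

open Classical in
/-- The chart of a leaf given by a plaque contained in it. -/
noncomputable def plaqueChart (h : IsPlaque Ψ Φ α β c δ σ)
    (hL : ∀ z ∈ ball c δ, σ z ∈ leaf Ψ Φ p) :
    PartialEquiv (LeafSpace Ψ Φ p) (EuclideanSpace ℝ (Fin 2)) where
  toFun x := coordMap α β x.val
  -- Outside the ball the value at the centre is an arbitrary default.
  invFun z := if hz : z ∈ ball c δ then ⟨σ z, hL z hz⟩ else ⟨σ c, hL c h.center_mem⟩
  source := {x | coordMap α β x.val ∈ ball c δ ∧ σ (coordMap α β x.val) = x.val}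
  target := ball c δ
  map_source' x hx := hx.1
  map_target' z hz := by
    rw [dif_pos hz]
    change coordMap α β (σ z) ∈ ball c δ ∧ σ (coordMap α β (σ z)) = σ z
    rw [h.coordMap_apply z hz]
    exact ⟨hz, rfl⟩
  left_inv' x hx := by
    rw [dif_pos hx.1]
    exact LeafSpace.ext hx.2
  right_inv' z hz := by
    rw [dif_pos hz]
    exact h.coordMap_apply z hz

theorem val_plaqueChart_symm (h : IsPlaque Ψ Φ α β c δ σ)
    (hL : ∀ z ∈ ball c δ, σ z ∈ leaf Ψ Φ p) {z : EuclideanSpace ℝ (Fin 2)} (hz : z ∈ ball c δ) :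
    ((plaqueChart h hL).symm z).val = σ z := by
  exact congrArg val (dif_pos hz)

/-- The charts given by the plaques contained in a leaf. -/
def plaqueAtlas (Ψ Φ : R4 → R3) (p : R4) :
    Set (PartialEquiv (LeafSpace Ψ Φ p) (EuclideanSpace ℝ (Fin 2))) :=
  {e | ∃ (α β : R4 →L[ℝ] ℝ) (c : EuclideanSpace ℝ (Fin 2)) (δ : ℝ)
    (σ : EuclideanSpace ℝ (Fin 2) → R4) (h : IsPlaque Ψ Φ α β c δ σ)
    (hL : ∀ z ∈ ball c δ, σ z ∈ leaf Ψ Φ p), e = plaqueChart h hL}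

/-- The rank stays two along the leaf, so every point is the centre of a plaque, and a plaque lies
in the leaf of its centre. -/
theorem exists_mem_plaqueAtlas (hΛ : IsPoissonTensor Ψ Φ) (hF : Φ p ⬝ᵥ Ψ p = 0)
    (hN : Φ p ⬝ᵥ Φ p + Ψ p ⬝ᵥ Ψ p ≠ 0) (x : LeafSpace Ψ Φ p) :
    ∃ e ∈ plaqueAtlas Ψ Φ p, x ∈ e.source := by
  obtain ⟨α, β, hk⟩ := exists_apply_sharp_ne_zero (norm_sq_ne_zero_of_mem_leaf hΛ x.val_mem hN)
  obtain ⟨δ, σ, h, hσ⟩ := exists_isPlaque hΛ (pfaffian_eq_zero_of_mem_leaf hΛ x.val_mem hF) hk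
  have hL : ∀ z ∈ ball (coordMap α β x.val) δ, σ z ∈ leaf Ψ Φ p := fun z hz => by
    rw [← leaf_eq_of_mem x.val_mem]
    nth_rw 1 [← hσ]
    exact h.mem_leaf hΛ hz
  exact ⟨_, ⟨α, β, _, δ, σ, h, hL, rfl⟩, h.center_mem, hσ⟩

theorem contDiffOn_plaqueChart_trans (hΛ : IsPoissonTensor Ψ Φ)
    {e e' : PartialEquiv (LeafSpace Ψ Φ p) (EuclideanSpace ℝ (Fin 2))}
    (he : e ∈ plaqueAtlas Ψ Φ p) (he' : e' ∈ plaqueAtlas Ψ Φ p) :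
    ContDiffOn ℝ ∞ (e.symm.trans e') (e.symm.trans e').source := by
  obtain ⟨α, β, c, δ, σ, h, hL, rfl⟩ := he
  obtain ⟨α', β', c', δ', σ', h', hL', rfl⟩ := he'
  refine ((coordMap α' β').contDiff.comp_contDiffOn
    ((h.contDiffOn hΛ).mono fun z hz => hz.1)).congr fun z hz => ?_
  change coordMap α' β' ((plaqueChart h hL).symm z).val = coordMap α' β' (σ z)
  rw [val_plaqueChart_symm h hL hz.1]

theorem isOpen_plaqueChart_trans_source (hΛ : IsPoissonTensor Ψ Φ)
    {e e' : PartialEquiv (LeafSpace Ψ Φ p) (EuclideanSpace ℝ (Fin 2))}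
    (he : e ∈ plaqueAtlas Ψ Φ p) (he' : e' ∈ plaqueAtlas Ψ Φ p) :
    IsOpen (e.symm.trans e').source := by
  obtain ⟨α, β, c, δ, σ, h, hL, rfl⟩ := he
  obtain ⟨α', β', c', δ', σ', h', hL', rfl⟩ := he'
  have hs : ((plaqueChart h hL).symm.trans (plaqueChart h' hL')).source
      = {z | z ∈ ball c δ ∧ coordMap α' β' (σ z) ∈ ball c' δ'
          ∧ σ' (coordMap α' β' (σ z)) = σ z} := by
    ext z
    refine and_congr_right fun hz => ?_
    change coordMap α' β' ((plaqueChart h hL).symm z).val ∈ ball c' δ' ∧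
      σ' (coordMap α' β' ((plaqueChart h hL).symm z).val) = ((plaqueChart h hL).symm z).val ↔ _
    rw [val_plaqueChart_symm h hL hz]
  rw [hs, isOpen_iff_mem_nhds]
  intro z hz
  exact (isOpen_ball.eventually_mem hz.1).and (h.eventually_mem hΛ h' hz.1 hz.2.1 hz.2.2.symm)

/-- The charts of a two-dimensional leaf. -/
noncomputable def core (hΛ : IsPoissonTensor Ψ Φ) (hF : Φ p ⬝ᵥ Ψ p = 0)
    (hN : Φ p ⬝ᵥ Φ p + Ψ p ⬝ᵥ Ψ p ≠ 0) :
    ChartedSpaceCore (EuclideanSpace ℝ (Fin 2)) (LeafSpace Ψ Φ p) where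
  atlas := plaqueAtlas Ψ Φ p
  chartAt x := (exists_mem_plaqueAtlas hΛ hF hN x).choose
  mem_chart_source x := (exists_mem_plaqueAtlas hΛ hF hN x).choose_spec.2
  chart_mem_atlas x := (exists_mem_plaqueAtlas hΛ hF hN x).choose_spec.1
  open_source _ _ he he' := isOpen_plaqueChart_trans_source hΛ he he'
  continuousOn_toFun _ _ he he' := (contDiffOn_plaqueChart_trans hΛ he he').continuousOn

section Manifold

variable (hΛ : IsPoissonTensor Ψ Φ) (hF : Φ p ⬝ᵥ Ψ p = 0) (hN : Φ p ⬝ᵥ Φ p + Ψ p ⬝ᵥ Ψ p ≠ 0)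

include hΛ hF hN

theorem exists_eq_openPartialHomeomorph : letI := (core hΛ hF hN).toTopologicalSpace
    letI := (core hΛ hF hN).toChartedSpace
    ∀ e ∈ atlas (EuclideanSpace ℝ (Fin 2)) (LeafSpace Ψ Φ p),
      ∃ (u : _) (hu : u ∈ (core hΛ hF hN).atlas),
        e = (core hΛ hF hN).openPartialHomeomorph u hu := by
  intro e he
  change e ∈ ⋃ (u : _) (hu : u ∈ (core hΛ hF hN).atlas),
    {(core hΛ hF hN).openPartialHomeomorph u hu} at he
  simpa only [mem_iUnion, mem_singleton_iff] using he

theorem isManifold : letI := (core hΛ hF hN).toTopologicalSpace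
    letI := (core hΛ hF hN).toChartedSpace
    IsManifold (𝓡 2) ∞ (LeafSpace Ψ Φ p) := by
  let := (core hΛ hF hN).toTopologicalSpace
  let := (core hΛ hF hN).toChartedSpace
  refine isManifold_of_contDiffOn (𝓡 2) ∞ _ fun e e' he he' => ?_
  obtain ⟨u, hu, rfl⟩ := exists_eq_openPartialHomeomorph hΛ hF hN e he
  obtain ⟨u', hu', rfl⟩ := exists_eq_openPartialHomeomorph hΛ hF hN e' he'
  exact (contDiffOn_plaqueChart_trans hΛ hu hu').mono fun x hx => hx.1

/-- An integral curve of a Hamiltonian vector field is continuous into its leaf. -/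
theorem continuous_integralCurve {H : R4 → ℝ} {γ : ℝ → R4} (hH : ContDiff ℝ ∞ H)
    (hγ : IsIntegralCurveOn γ (fun _ => hamiltonianField Ψ Φ H) (Icc 0 1))
    (hm : ∀ t : Icc (0 : ℝ) 1, γ t ∈ leaf Ψ Φ p) :
    letI := (core hΛ hF hN).toTopologicalSpace
    Continuous (fun t : Icc (0 : ℝ) 1 => (⟨γ t, hm t⟩ : LeafSpace Ψ Φ p)) := by
  let := (core hΛ hF hN).toTopologicalSpace
  refine continuous_iff_continuousAt.2 fun s => ?_
  obtain ⟨u, hu, hs⟩ := exists_mem_plaqueAtlas hΛ hF hN (⟨γ s, hm s⟩ : LeafSpace Ψ Φ p)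
  let e := (core hΛ hF hN).openPartialHomeomorph u hu
  have hse : (⟨γ s, hm s⟩ : LeafSpace Ψ Φ p) ∈ e.source := hs
  have hes : ContinuousAt e.symm (u ⟨γ s, hm s⟩) :=
    e.continuousAt_symm (e.map_source hse)
  -- Continuity in ℝ⁴ is not enough: the curve must remain in the same plaque, which tangency
  -- guarantees for times near `s`.
  have hlocal : ∀ᶠ t : Icc (0 : ℝ) 1 in 𝓝 s, (⟨γ t, hm t⟩ : LeafSpace Ψ Φ p) ∈ u.source := by
    obtain ⟨α, β, c, δ, σ, h, hL, rfl⟩ := hu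
    have h1 := h.eventually_eq_of_isTangentCurve hΛ (IsIntegralCurveOn.isTangentCurve hH hγ) s.2
      hs.1 hs.2
    have h2 := (eventually_nhds_subtype_iff (Icc (0 : ℝ) 1) s (fun t => coordMap α β (γ t) ∈ ball c δ ∧
      σ (coordMap α β (γ t)) = γ t)).2 h1
    exact h2
  have hcoord : ContinuousAt (fun t : Icc (0 : ℝ) 1 => u ⟨γ t, hm t⟩) s := by
    obtain ⟨α, β, c, δ, σ, h, hL, rfl⟩ := hu
    have h1 : Continuous (fun t : Icc (0 : ℝ) 1 => γ t) :=
      continuousOn_iff_continuous_domRestrict.1 hγ.continuousOn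
    exact ((coordMap α β).continuous.comp h1).continuousAt
  refine (ContinuousAt.comp (f := fun t : Icc (0 : ℝ) 1 => u ⟨γ t, hm t⟩) hes
    hcoord).congr ?_
  filter_upwards [hlocal] with t ht
  exact e.left_inv ht

/-- Any point is joined to `p` by finitely many arcs, each continuous for the plaque topology. -/
theorem connectedSpace : letI := (core hΛ hF hN).toTopologicalSpace
    ConnectedSpace (LeafSpace Ψ Φ p) := by
  let := (core hΛ hF hN).toTopologicalSpace
  refine connectedSpace_iff_connectedComponent.2 ⟨⟨p, mem_leaf_self p⟩,
    eq_univ_of_forall fun x => ?_⟩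
  have h : ∀ q ∈ leaf Ψ Φ p, ∃ hq, (⟨q, hq⟩ : LeafSpace Ψ Φ p) ∈
      connectedComponent (⟨p, mem_leaf_self p⟩ : LeafSpace Ψ Φ p) := fun q hq => by
    refine leaf_induction (P := fun q => ∃ hq, (⟨q, hq⟩ : LeafSpace Ψ Φ p) ∈
      connectedComponent (⟨p, mem_leaf_self p⟩ : LeafSpace Ψ Φ p))
      ⟨mem_leaf_self p, mem_connectedComponent⟩ (fun q r hq hqc harc => ?_) hq
    obtain ⟨H, γ, hH, rfl, rfl, hγ⟩ := harc
    have hm : ∀ t : Icc (0 : ℝ) 1, γ t ∈ leaf Ψ Φ p := fun t =>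
      (hamiltonianArc_of_mem_Icc hH hγ t.2).mem_leaf hq
    have hr := isPreconnected_range (continuous_integralCurve hΛ hF hN hH hγ hm)
    obtain ⟨_, hqc⟩ := hqc
    refine ⟨hm ⟨1, by simp⟩, ?_⟩
    rw [connectedComponent_eq hqc]
    exact hr.subset_connectedComponent ⟨⟨0, by simp⟩, rfl⟩ ⟨⟨1, by simp⟩, rfl⟩
  obtain ⟨_, hx⟩ := h x.val x.val_mem
  exact hx

theorem eqOn_val_comp_symm : letI := (core hΛ hF hN).toTopologicalSpace
    letI := (core hΛ hF hN).toChartedSpace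
    ∀ e ∈ atlas (EuclideanSpace ℝ (Fin 2)) (LeafSpace Ψ Φ p),
      ∃ (α β : R4 →L[ℝ] ℝ) (c : EuclideanSpace ℝ (Fin 2)) (δ : ℝ)
        (σ : EuclideanSpace ℝ (Fin 2) → R4), IsPlaque Ψ Φ α β c δ σ ∧ e.target = ball c δ ∧
          EqOn (val ∘ e.symm) σ (ball c δ) := by
  let := (core hΛ hF hN).toTopologicalSpace
  let := (core hΛ hF hN).toChartedSpace
  intro e he
  obtain ⟨u, hu, rfl⟩ := exists_eq_openPartialHomeomorph hΛ hF hN e he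
  have hu' := hu
  obtain ⟨α, β, c, δ, σ, h, hL, rfl⟩ := hu'
  exact ⟨α, β, c, δ, σ, h, rfl, fun z hz => val_plaqueChart_symm h hL hz⟩

end Manifold

end LeafSpace

/-- The leaf of a point where `Λ` has rank two is a symplectic leaf of dimension two. -/
theorem isSymplecticLeaf_leaf_of_pfaffian_eq_zero (hΛ : IsPoissonTensor Ψ Φ)
    (hF : Φ p ⬝ᵥ Ψ p = 0) (hN : Φ p ⬝ᵥ Φ p + Ψ p ⬝ᵥ Ψ p ≠ 0) :
    IsSymplecticLeaf Ψ Φ 2 (leaf Ψ Φ p) := by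
  let := (LeafSpace.core hΛ hF hN).toTopologicalSpace
  let := (LeafSpace.core hΛ hF hN).toChartedSpace
  have := LeafSpace.isManifold hΛ hF hN
  have := LeafSpace.connectedSpace hΛ hF hN
  have hF' : ∀ q ∈ leaf Ψ Φ p, Φ q ⬝ᵥ Ψ q = 0 := fun q hq =>
    pfaffian_eq_zero_of_mem_leaf hΛ hq hF
  have hN' : ∀ q ∈ leaf Ψ Φ p, Φ q ⬝ᵥ Φ q + Ψ q ⬝ᵥ Ψ q ≠ 0 := fun q hq =>
    norm_sq_ne_zero_of_mem_leaf hΛ hq hN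
  have hfd : ∀ e ∈ atlas (EuclideanSpace ℝ (Fin 2)) (LeafSpace Ψ Φ p), ∀ x ∈ e.target,
      ∃ α β : R4 →L[ℝ] ℝ, β (sharp Ψ Φ (e.symm x).val α) ≠ 0 ∧
        fderiv ℝ (LeafSpace.val ∘ e.symm) x = planeField Ψ Φ α β (e.symm x).val := by
    intro e he x hx
    obtain ⟨α, β, c, δ, σ, h, ht, heq⟩ := LeafSpace.eqOn_val_comp_symm hΛ hF hN e he
    rw [ht] at hx
    have h1 : (e.symm x).val = σ x := heq hx
    refine ⟨α, β, by rw [h1]; exact h.bracket_ne_zero x hx, ?_⟩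
    rw [(heq.eventuallyEq_of_mem (isOpen_ball.mem_nhds hx)).fderiv_eq, h1]
    exact (h.hasFDerivAt x hx).fderiv
  refine isSymplecticLeaf_of_charts (M := LeafSpace Ψ Φ p) ⟨p, rfl⟩ (ι := LeafSpace.val)
    LeafSpace.val_injective LeafSpace.range_val (fun e he => ?_) (fun e he x hx => ?_)
    (fun e he x hx => ?_)
    (A := fun x => (Φ x ⬝ᵥ Φ x + Ψ x ⬝ᵥ Ψ x)⁻¹ • Ψ x)
    (B := fun x => (Φ x ⬝ᵥ Φ x + Ψ x ⬝ᵥ Ψ x)⁻¹ • Φ x)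
    (fun q hq => (hΛ.contDiff_norm_sq.contDiffAt.inv (hN' q hq)).smul hΛ.smooth_Ψ.contDiffAt)
    (fun q hq => (hΛ.contDiff_norm_sq.contDiffAt.inv (hN' q hq)).smul hΛ.smooth_Φ.contDiffAt)
    (fun q hq => twoForm_sharp_sharp_of_eq_zero (hN' q hq) (hF' q hq))
    (fun q _ T => extDeriv_comp_eq_zero_of_lt (by simp) _ T)
  · obtain ⟨α, β, c, δ, σ, h, ht, heq⟩ := LeafSpace.eqOn_val_comp_symm hΛ hF hN e he
    rw [ht]
    exact (h.contDiffOn hΛ).congr heq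
  · obtain ⟨α, β, hk, hd⟩ := hfd e he x hx
    rw [hd]
    exact planeField_injective hk
  · obtain ⟨α, β, hk, hd⟩ := hfd e he x hx
    rw [hd]
    exact range_planeField (hF' _ (e.symm x).val_mem) hk

end RankTwo

end PoissonR4

namespace PoissonR4

open Set

/-! ### Assembly of the three statements -/

section Main

variable {Ψ Φ : R4 → R3}

theorem isSymplecticLeaf_four_iff (hΛ : IsPoissonTensor Ψ Φ) (L : Set R4) :
    IsSymplecticLeaf Ψ Φ 4 L ↔ IsComponentOf L (Splus Ψ Φ) ∨ IsComponentOf L (Sminus Ψ Φ) := by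
  constructor
  · intro h
    obtain ⟨p, rfl, hp⟩ := pfaffian_ne_zero_of_isSymplecticLeaf h
    rcases hp.lt_or_gt with hp | hp
    · exact Or.inr ⟨p, hp, leaf_eq_connectedComponentIn_Sminus hΛ hp⟩
    · exact Or.inl ⟨p, hp, leaf_eq_connectedComponentIn_Splus hΛ hp⟩
  · rintro (⟨p, hp, rfl⟩ | ⟨p, hp, rfl⟩)
    · have hc := isConnected_connectedComponentIn_iff.2 hp
      rw [← leaf_eq_connectedComponentIn_Splus hΛ hp] at hc ⊢
      exact isSymplecticLeaf_leaf_of_pfaffian_ne_zero hΛ (ne_of_gt hp) hc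
    · have hc := isConnected_connectedComponentIn_iff.2 hp
      rw [← leaf_eq_connectedComponentIn_Sminus hΛ hp] at hc ⊢
      exact isSymplecticLeaf_leaf_of_pfaffian_ne_zero hΛ (ne_of_lt hp) hc

theorem isComponentOf_self_of_isConnected {S : Set R4} (hS : IsConnected S) :
    IsComponentOf S S := by
  obtain ⟨p, hp⟩ := hS.nonempty
  exact ⟨p, hp, (hS.isPreconnected.connectedComponentIn hp).symm⟩

theorem sUnion_leaves_eq_Szero (hΛ : IsPoissonTensor Ψ Φ) :
    ⋃₀ {L : Set R4 | IsLeaf Ψ Φ L ∧ L ⊆ Szero Ψ Φ} = Szero Ψ Φ :=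
  Subset.antisymm (sUnion_subset fun _ hL => hL.2) fun p hp =>
    ⟨leaf Ψ Φ p, ⟨⟨p, rfl⟩, fun _ hq => pfaffian_eq_zero_of_mem_leaf hΛ hq hp⟩, mem_leaf_self p⟩

theorem pairwiseDisjoint_leaves (S : Set R4) :
    {L : Set R4 | IsLeaf Ψ Φ L ∧ L ⊆ S}.PairwiseDisjoint id := by
  rintro _ ⟨⟨p, rfl⟩, _⟩ _ ⟨⟨q, rfl⟩, _⟩ hne
  refine disjoint_left.2 fun r hp hq => hne ?_
  rw [← leaf_eq_of_mem (id hp : r ∈ leaf Ψ Φ p), leaf_eq_of_mem (id hq : r ∈ leaf Ψ Φ q)]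

theorem isSymplecticLeaf_of_subset_Szero (hΛ : IsPoissonTensor Ψ Φ) {L : Set R4}
    (hL : IsLeaf Ψ Φ L) (hS : L ⊆ Szero Ψ Φ) :
    IsSymplecticLeaf Ψ Φ 2 L ∨ IsSymplecticLeaf Ψ Φ 0 L := by
  obtain ⟨p, rfl⟩ := hL
  by_cases hN : Φ p ⬝ᵥ Φ p + Ψ p ⬝ᵥ Ψ p = 0
  · exact Or.inr (isSymplecticLeaf_leaf_of_norm_sq_eq_zero hΛ hN)
  · exact Or.inl (isSymplecticLeaf_leaf_of_pfaffian_eq_zero hΛ (hS (mem_leaf_self p)) hN)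

end Main

end PoissonR4

theorem mainTheorem1 (Ψ Φ : R4 → R3) (hΛ : IsPoissonTensor Ψ Φ) :
    -- the rank at a point
    (∀ p : R4,
      (rank Ψ Φ p = 0 ↔ Φ p ⬝ᵥ Φ p + Ψ p ⬝ᵥ Ψ p = 0) ∧
      (rank Ψ Φ p = 2 ↔ Φ p ⬝ᵥ Φ p + Ψ p ⬝ᵥ Ψ p ≠ 0 ∧ Φ p ⬝ᵥ Ψ p = 0) ∧
      (rank Ψ Φ p = 4 ↔ Φ p ⬝ᵥ Ψ p ≠ 0)) ∧
    -- the 4-dimensional symplectic leaves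
    IsOpen (Splus Ψ Φ) ∧ IsOpen (Sminus Ψ Φ) ∧
    (∀ L : Set R4, IsSymplecticLeaf Ψ Φ 4 L ↔
      IsComponentOf L (Splus Ψ Φ) ∨ IsComponentOf L (Sminus Ψ Φ)) ∧
    (IsConnected (Splus Ψ Φ) → IsSymplecticLeaf Ψ Φ 4 (Splus Ψ Φ)) ∧
    (IsConnected (Sminus Ψ Φ) → IsSymplecticLeaf Ψ Φ 4 (Sminus Ψ Φ)) ∧
    -- the zero set of `Φ · Ψ` is partitioned into symplectic leaves of dimension 2 and 0
    ⋃₀ {L : Set R4 | IsLeaf Ψ Φ L ∧ L ⊆ Szero Ψ Φ} = Szero Ψ Φ ∧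
    {L : Set R4 | IsLeaf Ψ Φ L ∧ L ⊆ Szero Ψ Φ}.PairwiseDisjoint id ∧
    (∀ L : Set R4, IsLeaf Ψ Φ L → L ⊆ Szero Ψ Φ →
      IsSymplecticLeaf Ψ Φ 2 L ∨ IsSymplecticLeaf Ψ Φ 0 L) :=
  ⟨rank_characterization Ψ Φ,
    isOpen_lt continuous_const hΛ.contDiff_pfaffian.continuous,
    isOpen_lt hΛ.contDiff_pfaffian.continuous continuous_const,
    isSymplecticLeaf_four_iff hΛ,
    fun h => (isSymplecticLeaf_four_iff hΛ _).2 (Or.inl (isComponentOf_self_of_isConnected h)),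
    fun h => (isSymplecticLeaf_four_iff hΛ _).2 (Or.inr (isComponentOf_self_of_isConnected h)),
    sUnion_leaves_eq_Szero hΛ, pairwiseDisjoint_leaves (Szero Ψ Φ),
    fun _ => isSymplecticLeaf_of_subset_Szero hΛ⟩
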